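/- Let $K$ be a field, let $m \ge 1$ and $n = m+2 \ge 3$, and let $R = K[x_1,\dots,x_{n-1}]$ with its usual grading and $\mathfrak m=(x_1,\dots,x_{n-1})$. Let $X \subset \mathbb P^{n-2}$ be the standard set of $n$ points $$(1:0:\cdots:0),\ (0:1:0:\cdots:0),\ \dots,\ (0:\cdots:0:1),\ (1:1:\cdots:1),$$ and let $I \subset R$ be its homogeneous ideal, i.e. the ideal generated by all homogeneous polynomials vanishing on $X$. Let $F_\bullet$ be any minimal graded free resolution of $R/I$: a finite complex of graded free $R$-modules of finite rank, with grading-preserving maps $\phi_k : F_k \to F_{k-1}$ ($k \ge 1$), exact in positive degrees, with $F_0/\phi_1(F_1) \cong R/I$ as graded modules, and with $\phi_k(F_k) \subset \mathfrak m F_{k-1}$ for all $k \ge 1$. Choose homogeneous bases of the $F_k$ and write $\phi_k$ also for the matrices of the maps. Then $F_0$ and $F_{n-2}$ have rank $1$, so that for $1 \le a_1,\dots,a_{n-2} \le n-1$ the matrix product $$[a_1,\dots,a_{n-2}] = \frac{\partial \phi_1}{\partial x_{a_1}} \frac{\partial \phi_2}{\partial x_{a_2}} \cdots \frac{\partial \phi_{n-2}}{\partial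 x_{a_{n-2}}}$$ (with entrywise partial derivatives) is a single polynomial. Put $$[[a_1,\dots,a_{n-2}]] = \sum_{k=1}^{n-2} [a_{\sigma^{2k}(1)},\dots,a_{\sigma^{2k}(n-2)}], \qquad \sigma = (1\,2\,\cdots\,n-2),$$ and $\Omega_j = (-1)^j [[1,\dots,\widehat{j},\dots,n-1]]$ for $1 \le j \le n-1$. Then: (i) There is a scalar $\lambda \in K$, $\lambda \ne 0$, such that whenever $a_1,\dots,a_{n-2},b$ is a permutation of $1,\dots,n-1$, $$[a_1,\dots,a_{n-2}] = \pm \lambda\,(x_b - x_{a_1} - x_{a_{n-2}})\,x_b,$$ where $\pm$ is the sign of the permutation. (ii) There is a scalar $c \in K$, $c \neq 0$, such that for all $1 \le i \le n-1$, $$\Omega_i = c\,\Bigl(n x_i^2 - 2 x_i \sum_{j=1}^{n-1} x_j\Bigr).$$ -/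

import Mathlib

open MvPolynomial

/-- `p` is zero, or homogeneous of degree `e` (an integer; only zero has negative degree). -/
def IsHomogeneousOfIntDegree {σ K : Type*} [CommSemiring K] (p : MvPolynomial σ K) (e : ℤ) :
    Prop :=
  p = 0 ∨ ∃ d : ℕ, (d : ℤ) = e ∧ p.IsHomogeneous d

/-- A minimal graded free resolution of `R ⧸ I`, where `R = K[x_i : i ∈ σ]` and `I` is a
homogeneous ideal, by graded free modules of finite rank with chosen homogeneous bases:
`F_k = ⨁ j, R(-deg k j)` with `j` running over `Fin (rank k)`, and the matrix `φ k` represents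
the differential `φ_{k+1} : F_{k+1} → F_k` (acting on column vectors). -/
structure MinimalFreeResolution {σ K : Type*} [Field K] (I : Ideal (MvPolynomial σ K)) where
  /-- the rank of `F_k` -/
  rank : ℕ → ℕ
  /-- the degrees of the basis vectors of `F_k` -/
  deg : ∀ k, Fin (rank k) → ℤ
  /-- the matrix of `F_{k+1} → F_k` -/
  φ : ∀ k, Matrix (Fin (rank k)) (Fin (rank (k + 1))) (MvPolynomial σ K)
  /-- the augmentation, inducing the isomorphism of `F_0 / φ_1(F_1)` with `R ⧸ I` -/
  aug : (Fin (rank 0) → MvPolynomial σ K) →ₗ[MvPolynomial σ K] (MvPolynomial σ K ⧸ I)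
  /-- the complex has finite length -/
  finite_length : ∃ r, ∀ k, r < k → rank k = 0
  /-- the differentials respect the gradings -/
  φ_graded : ∀ k i j, IsHomogeneousOfIntDegree (φ k i j) (deg (k + 1) j - deg k i)
  /-- the augmentation respects the gradings -/
  aug_graded : ∀ i, ∃ p : MvPolynomial σ K, IsHomogeneousOfIntDegree p (deg 0 i) ∧
    aug (Pi.single i 1) = Ideal.Quotient.mk I p
  /-- exactness at `F_{k+1}` -/
  exact : ∀ k, Function.Exact (φ (k + 1)).mulVecLin (φ k).mulVecLin
  /-- exactness at `F_0` of the augmented complex -/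
  exact_aug : Function.Exact (φ 0).mulVecLin aug
  aug_surjective : Function.Surjective aug
  /-- minimality: `φ_{k+1}(F_{k+1}) ⊆ 𝔪 F_k` for the ideal `𝔪` generated by the variables -/
  minimal : ∀ k i j,
    φ k i j ∈ Ideal.span (Set.range (X : σ → MvPolynomial σ K))

namespace MinimalFreeResolution

variable {σ K : Type*} [Field K] {I : Ideal (MvPolynomial σ K)}

/-- The product `(∂φ_1/∂x_{a_1}) (∂φ_2/∂x_{a_2}) ⋯ (∂φ_k/∂x_{a_k})` of entrywise partial
derivatives, a matrix with `rank 0` rows and `rank k` columns. -/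
noncomputable def bracket (F : MinimalFreeResolution I) :
    (k : ℕ) → (Fin k → σ) → Matrix (Fin (F.rank 0)) (Fin (F.rank k)) (MvPolynomial σ K)
  | 0, _ => 1
  | k + 1, a =>
      F.bracket k (fun i => a i.castSucc) * (F.φ k).map (fun p => pderiv (a (Fin.last k)) p)

/-- `[[a_1, …, a_m]] = ∑_{k=1}^m [a_{s^{2k}(1)}, …, a_{s^{2k}(m)}]`, where `s` is the cyclic
permutation `i ↦ i + 1` of the `m` positions. -/
noncomputable def doubleBracket (F : MinimalFreeResolution I) (m : ℕ) (a : Fin m → σ) :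
    Matrix (Fin (F.rank 0)) (Fin (F.rank m)) (MvPolynomial σ K) :=
  ∑ k ∈ Finset.Icc 1 m, F.bracket m (fun i => a ((finRotate m ^ (2 * k)) i))

/-- `Ω_j = (-1)^j [[1, …, ĵ, …, m+1]]` in the variables `x_1, …, x_{m+1}`. The variables are
indexed from zero by `Fin (m + 1)`, whence the exponent `j + 1`. -/
noncomputable def Omega {m : ℕ} {I : Ideal (MvPolynomial (Fin (m + 1)) K)}
    (F : MinimalFreeResolution I) (j : Fin (m + 1)) :
    Matrix (Fin (F.rank 0)) (Fin (F.rank m)) (MvPolynomial (Fin (m + 1)) K) :=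
  (-1 : ℤ) ^ ((j : ℕ) + 1) • F.doubleBracket m j.succAbove

end MinimalFreeResolution

/-- The homogeneous ideal of a set of points of projective space: the ideal generated by the
homogeneous polynomials that vanish at all points of the set. -/
noncomputable def projVanishingIdeal {σ K : Type*} [Field K]
    (S : Set (Projectivization K (σ → K))) : Ideal (MvPolynomial σ K) :=
  Ideal.span {p | (∃ d, p.IsHomogeneous d) ∧ ∀ P ∈ S, eval P.rep p = 0}

/-- The standard `m + 2` points of `ℙ^m`: the coordinate points and `(1 : ⋯ : 1)`. -/
def standardPoints (K : Type*) [Field K] (m : ℕ) :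
    Set (Projectivization K (Fin (m + 1) → K)) :=
  {P | (∃ i, P = Projectivization.mk K (Pi.single i 1) (by simp)) ∨
    P = Projectivization.mk K (fun _ => 1) (fun h => one_ne_zero (congrFun h 0))}

/-! The shape of the resolution comes first. Generators of `F_k` in degree d are detected by
Tor_k(R/I, K) in degree d, which the Koszul complex of the variables computes. A form lies in I
exactly if it vanishes at the n standard vectors, so the Koszul homology of R/I reduces to
interpolation at these vectors (`koszulVanish`, `rank_last_ne_zero`). Outcome: `F_0` is R, the
generators of `F_k` have degree k + 1 for 0 < k < m, those of `F_m` have degree m + 2, and `F_m` is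
nonzero. For m ≥ 2 the first and last matrices therefore consist of quadrics and all others of
linear forms.

Write a linear differential as ∑ x_a A_a with constant matrices A_a, its slopes. Since the
differentials compose to zero, consecutive slopes anticommute and A_a A_a = 0. Take the row of
coefficients of x_a x_b in the first matrix, multiply it by slopes in m - 2 other directions and by
a column y of the last matrix. This gives a quadric for each pair among the three directions left
over. The three quadrics add up to zero, because the generators of I vanish at (1 : ⋯ : 1), and they
satisfy a second relation, because y is a cycle. By `exists_scalar_of_syzygies` the two relations
determine them up to one scalar μ.

A transposition of the directions changes the sign of μ (`LinearStrand.hasScalar_swap`), and by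
minimality μ = 0 forces y = 0 (`LinearStrand.eq_zero_of_hasScalar_zero`). Hence μ is an injective
linear functional on constant combinations of the columns, so `F_m` has rank one and μ ≠ 0 for its
generator. The bracket is a sum of terms x_c times a derivative of such a quadric; only two values
of c contribute, which gives (i). In the sum defining Ω_j every position serves twice as an end
position, which gives (ii) from (i). For m = 1 the only differential is a cubic, treated directly in
`bracket_of_one`. -/

section Koszul

/-! ### Exterior algebra in coordinates and the Koszul differential. -/

variable {σ : Type*} [LinearOrder σ]

/-- The sign with which the exterior generator `a` is moved into the wedge monomial `S`. -/
def wedgeSign (a : σ) (S : Finset σ) : ℤ := (-1) ^ (S.filter (· < a)).card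

theorem wedgeSign_mul_self (a : σ) (S : Finset σ) : wedgeSign a S * wedgeSign a S = 1 := by
  rw [wedgeSign, ← mul_pow]; simp

theorem wedgeSign_insert {a b : σ} {S : Finset σ} (hb : b ∉ S) :
    wedgeSign a (insert b S) = if b < a then -wedgeSign a S else wedgeSign a S := by
  unfold wedgeSign
  rw [Finset.filter_insert]
  split_ifs with h
  · rw [Finset.card_insert_of_notMem (by simp [hb]), pow_succ]; ring
  · rfl

theorem wedgeSign_comm {a b : σ} {S : Finset σ} (ha : a ∉ S) (hb : b ∉ S) (hab : a ≠ b) :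
    wedgeSign a S * wedgeSign b (insert a S) = -(wedgeSign b S * wedgeSign a (insert b S)) := by
  rw [wedgeSign_insert ha, wedgeSign_insert hb]
  rcases lt_or_gt_of_ne hab with h | h
  · rw [if_pos h, if_neg h.not_gt]; ring
  · rw [if_neg h.not_gt, if_pos h]; ring

theorem wedgeSign_comm' {a b : σ} {S : Finset σ} (ha : a ∉ S) (hb : b ∉ S) (hab : a ≠ b) :
    wedgeSign b (insert a S) * wedgeSign a (insert b S) = -(wedgeSign b S * wedgeSign a S) := by
  rw [wedgeSign_insert ha, wedgeSign_insert hb]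
  rcases lt_or_gt_of_ne hab with h | h
  · rw [if_pos h, if_neg h.not_gt]; ring
  · rw [if_neg h.not_gt, if_pos h]; ring

variable {N : Type*} [AddCommGroup N]

/-- Contraction of an element of `N ⊗ Λ`, written as a function on wedge monomials, with the
`a`-th dual basis vector. -/
def contractBasis (a : σ) : (Finset σ → N) →+ (Finset σ → N) where
  toFun c S := if a ∈ S then 0 else wedgeSign a S • c (insert a S)
  map_zero' := by ext; simp
  map_add' c d := by ext S; by_cases h : a ∈ S <;> simp [h]

/-- Exterior multiplication by the `a`-th basis vector. -/
def wedgeBasis (a : σ) : (Finset σ → N) →+ (Finset σ → N) where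
  toFun c S := if a ∈ S then wedgeSign a (S.erase a) • c (S.erase a) else 0
  map_zero' := by ext; simp
  map_add' c d := by ext S; by_cases h : a ∈ S <;> simp [h]

theorem contractBasis_apply (a : σ) (c : Finset σ → N) (S : Finset σ) :
    contractBasis a c S = if a ∈ S then 0 else wedgeSign a S • c (insert a S) := rfl

theorem wedgeBasis_apply (a : σ) (c : Finset σ → N) (S : Finset σ) :
    wedgeBasis a c S = if a ∈ S then wedgeSign a (S.erase a) • c (S.erase a) else 0 := rfl

theorem contractBasis_map {N' : Type*} [AddCommGroup N'] (f : N →+ N') (a : σ)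
    (c : Finset σ → N) (S : Finset σ) :
    contractBasis a (fun T => f (c T)) S = f (contractBasis a c S) := by
  simp only [contractBasis_apply]; split_ifs <;> simp

theorem contractBasis_contractBasis_self (a : σ) (c : Finset σ → N) :
    contractBasis a (contractBasis a c) = 0 := by
  ext S; simp [contractBasis_apply]

theorem contractBasis_anticomm (a b : σ) (c : Finset σ → N) :
    contractBasis a (contractBasis b c) = -contractBasis b (contractBasis a c) := by
  by_cases hab : a = b
  · subst hab; simp [contractBasis_contractBasis_self]
  ext S
  simp only [contractBasis_apply, Pi.neg_apply, Finset.mem_insert]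
  by_cases ha : a ∈ S <;> by_cases hb : b ∈ S <;> simp [ha, hb, hab, Ne.symm hab]
  rw [smul_smul, smul_smul, wedgeSign_comm ha hb hab, Finset.insert_comm]; simp

theorem contractBasis_wedgeBasis_self (a : σ) (c : Finset σ → N) :
    contractBasis a (wedgeBasis a c) + wedgeBasis a (contractBasis a c) = c := by
  ext S
  simp only [contractBasis_apply, wedgeBasis_apply, Pi.add_apply]
  by_cases ha : a ∈ S
  · simp [ha, smul_smul, wedgeSign_mul_self]
  · simp [ha, smul_smul, wedgeSign_mul_self]

theorem contractBasis_wedgeBasis_of_ne {a b : σ} (hab : a ≠ b) (c : Finset σ → N) :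
    contractBasis b (wedgeBasis a c) + wedgeBasis a (contractBasis b c) = 0 := by
  ext S
  simp only [contractBasis_apply, wedgeBasis_apply, Pi.add_apply]
  by_cases hb : b ∈ S
  · simp [hb, Ne.symm hab]
  by_cases ha : a ∈ S
  · obtain ⟨T, haT, rfl⟩ : ∃ T, a ∉ T ∧ S = insert a T :=
      ⟨S.erase a, by simp, by simp [ha]⟩
    have hbT : b ∉ T := fun h => hb (by simp [h])
    have hb' : b ∉ (insert a T).erase a := by simp [haT, hbT]
    have : (insert b (insert a T)).erase a = insert b T := by
      rw [Finset.insert_comm, Finset.erase_insert (by simp [hab, haT])]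
    simp only [hb, Finset.erase_insert haT, this, hbT, Finset.mem_insert_self, Finset.mem_insert,
      or_true, if_true, if_false, smul_smul]
    rw [wedgeSign_comm' haT hbT hab, ← add_smul, mul_comm (wedgeSign b T)]; simp
  · simp [hb, ha, hab]

variable {A : Type*} [CommRing A] [Module A N]

theorem contractBasis_smul (a : σ) (x : A) (c : Finset σ → N) :
    contractBasis a (x • c) = x • contractBasis a c := by
  ext S; simp only [contractBasis_apply, Pi.smul_apply]
  split_ifs
  · simp
  · exact smul_comm _ _ _

theorem wedgeBasis_smul (a : σ) (x : A) (c : Finset σ → N) :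
    wedgeBasis a (x • c) = x • wedgeBasis a c := by
  ext S; simp only [wedgeBasis_apply, Pi.smul_apply]
  split_ifs
  · exact smul_comm _ _ _
  · simp

variable [Fintype σ]

/-- Contraction with the vector `x`: the Koszul differential of the sequence `x`. -/
def contract (x : σ → A) : (Finset σ → N) →ₗ[A] (Finset σ → N) where
  toFun c := ∑ b, x b • contractBasis b c
  map_add' c d := by simp [Finset.sum_add_distrib]
  map_smul' r c := by simp [contractBasis_smul, Finset.smul_sum, smul_comm r]

theorem contract_apply (x : σ → A) (c : Finset σ → N) :
    contract x c = ∑ b, x b • contractBasis b c := rfl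

theorem contract_apply_apply (x : σ → A) (c : Finset σ → N) (S : Finset σ) :
    contract x c S = ∑ b, x b • contractBasis b c S := by
  simp [contract_apply, Finset.sum_apply]

theorem contract_contract (x : σ → A) (c : Finset σ → N) : contract x (contract x c) = 0 := by
  simp only [contract_apply, map_sum, contractBasis_smul, smul_smul]
  rw [← Finset.sum_product']
  refine Finset.sum_involution (fun p _ => (p.2, p.1)) ?_ ?_ (by simp) (by simp)
  · rintro ⟨a, b⟩ _
    simp only
    rw [contractBasis_anticomm a b, mul_comm]; simp
  · rintro ⟨a, b⟩ _ h heq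
    obtain rfl : b = a := by simpa using congrArg Prod.fst heq
    exact h (by simp [contractBasis_contractBasis_self])

/-- Wedging with `a` is a homotopy between multiplication by `x a` and zero. It contracts the
complex where `x a = 1`, which happens at the standard vectors; for the variables it is combined
with division by `X a`. -/
theorem contract_wedgeBasis (x : σ → A) (a : σ) (c : Finset σ → N) :
    contract x (wedgeBasis a c) + wedgeBasis a (contract x c) = x a • c := by
  simp only [contract_apply, map_sum, wedgeBasis_smul, ← Finset.sum_add_distrib, ← smul_add]
  rw [Finset.sum_eq_single a]
  · rw [contractBasis_wedgeBasis_self]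
  · intro b _ hb; rw [contractBasis_wedgeBasis_of_ne hb.symm, smul_zero]
  · simp

theorem contract_map {N' : Type*} [AddCommGroup N'] [Module A N'] (f : N →ₗ[A] N') (x : σ → A)
    (c : Finset σ → N) : contract x (fun S => f (c S)) = fun S => f (contract x c S) := by
  ext S
  simp only [contract_apply_apply, map_sum, map_smul]
  exact Finset.sum_congr rfl fun b _ => by
    congr 1; exact contractBasis_map f.toAddMonoidHom b c S

theorem contract_map_ringHom {B : Type*} [CommRing B] (f : A →+* B) (x : σ → A)
    (c : Finset σ → A) :
    contract (fun i => f (x i)) (fun S => f (c S)) = fun S => f (contract x c S) := by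
  ext S
  simp only [contract_apply_apply, map_sum, smul_eq_mul, map_mul]
  exact Finset.sum_congr rfl fun b _ => by
    congr 1; exact contractBasis_map f.toAddMonoidHom b c S

end Koszul

/-! ### Exactness of the Koszul complex of the variables. -/

section DivX

variable {σ K : Type*} [Field K]

/-- Division by `X a`, discarding the remainder. -/
noncomputable def divX (a : σ) : MvPolynomial σ K →+ MvPolynomial σ K where
  toFun p := p.divMonomial (Finsupp.single a 1)
  map_zero' := zero_divMonomial _
  map_add' _ _ := add_divMonomial _ _ _

theorem coeff_divX (a : σ) (p : MvPolynomial σ K) (s : σ →₀ ℕ) :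
    coeff s (divX a p) = coeff (Finsupp.single a 1 + s) p := coeff_divMonomial _ _ _

theorem divX_X_mul (a : σ) (p : MvPolynomial σ K) : divX a (X a * p) = p :=
  X_mul_divMonomial a p

theorem divX_X_mul_of_ne {a b : σ} (h : b ≠ a) (p : MvPolynomial σ K) :
    divX a (X b * p) = X b * divX a p := by
  classical
  ext s
  rw [coeff_divX, coeff_X_mul', coeff_X_mul', coeff_divX]
  have : b ∈ (Finsupp.single a 1 + s).support ↔ b ∈ s.support := by
    simp [h.symm]
  simp only [this]
  split_ifs with hb
  · congr 1
    ext i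
    simp only [Finsupp.tsub_apply, Finsupp.add_apply, Finsupp.single_apply]
    by_cases hi : b = i
    · subst hi; simp [h.symm]
    · simp [hi]
  · rfl

end DivX

section KoszulExact

variable {σ K : Type*} [LinearOrder σ] [Fintype σ] [Field K]

theorem coeff_zero_contract_X {r : ℕ} (c : Finset σ → (Fin r → MvPolynomial σ K)) (S : Finset σ)
    (i : Fin r) : coeff 0 (contract (X : σ → MvPolynomial σ K) c S i) = 0 := by
  rw [contract_apply_apply]
  simp only [Finset.sum_apply, coeff_sum, Pi.smul_apply, smul_eq_mul]
  exact Finset.sum_eq_zero fun b _ => by simp [coeff_X_mul']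

theorem coeff_zero_contract_X' (c : Finset σ → MvPolynomial σ K) (S : Finset σ) :
    coeff 0 (contract (X : σ → MvPolynomial σ K) c S) = 0 := by
  rw [contract_apply_apply]
  simp only [coeff_sum, smul_eq_mul]
  exact Finset.sum_eq_zero fun b _ => by simp [coeff_X_mul']

/-- One step of the contraction of the Koszul complex: up to a boundary a cycle can be freed of
one wedge generator and of the corresponding variable. -/
theorem koszul_homotopy (a : σ) (c : Finset σ → MvPolynomial σ K)
    (hc : contract (X : σ → MvPolynomial σ K) c = 0) (S : Finset σ) :
    (c - contract (X : σ → MvPolynomial σ K) (wedgeBasis a (fun T => divX a (c T)))) S =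
      if a ∈ S then 0 else c S - X a * divX a (c S) := by
  set c' : Finset σ → MvPolynomial σ K := fun T => divX a (c T)
  have h1 := congrFun (contract_wedgeBasis (X : σ → MvPolynomial σ K) a c') S
  -- Divide the equation `contract X c = 0` by `X a`. The terms with `b ≠ a` commute with the
  -- division, while the term of `a` loses its factor `X a` instead of having its coefficient
  -- divided; the difference is the contraction of `c`.
  have h2 : ∀ T, contract (X : σ → MvPolynomial σ K) c' T =
      X a * contractBasis a c' T - contractBasis a c T := by
    intro T
    have h3 : divX a (contract (X : σ → MvPolynomial σ K) c T) = 0 := by rw [hc]; simp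
    rw [contract_apply_apply, map_sum, ← Finset.add_sum_erase _ _ (Finset.mem_univ a)] at h3
    rw [contract_apply_apply, ← Finset.add_sum_erase _ _ (Finset.mem_univ a)]
    simp only [smul_eq_mul, divX_X_mul] at h3 ⊢
    have h4 : ∑ x ∈ Finset.univ.erase a, X x * contractBasis x c' T =
        ∑ x ∈ Finset.univ.erase a, divX a (X x * contractBasis x c T) := by
      refine Finset.sum_congr rfl fun b hb => ?_
      rw [divX_X_mul_of_ne (Finset.ne_of_mem_erase hb)]
      congr 1
      exact contractBasis_map (divX a) b c T
    rw [h4]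
    linear_combination h3
  simp only [Pi.add_apply, Pi.smul_apply, smul_eq_mul] at h1
  have h5 : wedgeBasis a (contract (X : σ → MvPolynomial σ K) c') S =
      if a ∈ S then X a * c' S - c S else 0 := by
    rw [wedgeBasis_apply]
    split_ifs with ha
    · rw [h2, contractBasis_apply, contractBasis_apply, if_neg (by simp), if_neg (by simp),
        Finset.insert_erase ha, mul_smul_comm, ← smul_sub, smul_smul, wedgeSign_mul_self, one_smul]
    · rfl
  rw [h5] at h1
  rw [Pi.sub_apply]
  split_ifs at h1 ⊢ with ha
  · linear_combination -h1
  · linear_combination -h1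

/-- The Koszul complex of the variables is exact, except for the constants in degree zero. -/
theorem exists_contract_X_eq (c : Finset σ → MvPolynomial σ K)
    (hc : contract (X : σ → MvPolynomial σ K) c = 0) (h0 : coeff 0 (c ∅) = 0) :
    ∃ w, c = contract (X : σ → MvPolynomial σ K) w := by
  -- The variables are eliminated one at a time. Once `a` has been treated, neither the wedge
  -- generator `a` nor the variable `X a` occurs, and later steps preserve this. In the end only a
  -- constant at `∅` could survive, which `h0` excludes.
  have key : ∀ A : Finset σ, ∃ w : Finset σ → MvPolynomial σ K, ∀ S, (∀ a ∈ A, a ∈ S →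
      (c - contract (X : σ → MvPolynomial σ K) w) S = 0) ∧ ∀ s : σ →₀ ℕ, ∀ a ∈ A, s a ≠ 0 →
      coeff s ((c - contract (X : σ → MvPolynomial σ K) w) S) = 0 := by
    intro A
    induction A using Finset.induction_on with
    | empty => exact ⟨0, by simp⟩
    | insert a A _ ih =>
      obtain ⟨w, hw⟩ := ih
      set d := c - contract (X : σ → MvPolynomial σ K) w with hd
      have hdc : contract (X : σ → MvPolynomial σ K) d = 0 := by
        rw [hd, map_sub, hc, contract_contract, sub_zero]
      refine ⟨w + wedgeBasis a (fun T => divX a (d T)), fun S => ?_⟩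
      have h1 : (c - contract (X : σ → MvPolynomial σ K)
          (w + wedgeBasis a (fun T => divX a (d T)))) S =
          if a ∈ S then 0 else d S - X a * divX a (d S) := by
        rw [← koszul_homotopy a d hdc S, map_add, hd, sub_sub]
      rw [h1]
      constructor
      · intro b hb hbS
        split_ifs with ha
        · rfl
        · obtain rfl | hb := Finset.mem_insert.1 hb
          · exact absurd hbS ha
          · rw [(hw S).1 b hb hbS]; simp
      · intro s b hb hsb
        split_ifs with ha
        · simp
        · rw [coeff_sub, coeff_X_mul', coeff_divX]
          have h2 : a ∈ s.support → Finsupp.single a 1 + (s - Finsupp.single a 1) = s := by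
            intro h
            rw [add_tsub_cancel_of_le]
            simpa [Nat.one_le_iff_ne_zero] using h
          split_ifs with has
          · rw [h2 has, sub_self]
          · obtain rfl | hb := Finset.mem_insert.1 hb
            · simp_all
            · rw [(hw S).2 s b hb hsb]; simp
  obtain ⟨w, hw⟩ := key Finset.univ
  refine ⟨w, ?_⟩
  rw [← sub_eq_zero]
  ext S s
  rw [Pi.zero_apply, coeff_zero]
  by_cases hS : S = ∅
  · subst hS
    by_cases hs : s = 0
    · subst hs
      rw [Pi.sub_apply, coeff_sub, h0, coeff_zero_contract_X', sub_zero]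
    · obtain ⟨a, ha⟩ := Finsupp.ne_iff.1 hs
      exact (hw ∅).2 s a (Finset.mem_univ a) (by simpa using ha)
  · obtain ⟨a, ha⟩ := Finset.nonempty_iff_ne_empty.2 hS
    rw [(hw S).1 a (Finset.mem_univ a) ha, coeff_zero]

theorem contract_X_apply_coord {r : ℕ} (c : Finset σ → (Fin r → MvPolynomial σ K))
    (S : Finset σ) (i : Fin r) :
    contract (X : σ → MvPolynomial σ K) c S i =
      contract (X : σ → MvPolynomial σ K) (fun T => c T i) S :=
  (congrFun (contract_map (LinearMap.proj i) (X : σ → MvPolynomial σ K) c) S).symm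

theorem exists_contract_X_eq_pi {r : ℕ} (c : Finset σ → (Fin r → MvPolynomial σ K))
    (hc : contract (X : σ → MvPolynomial σ K) c = 0) (h0 : ∀ i, coeff 0 (c ∅ i) = 0) :
    ∃ w, c = contract (X : σ → MvPolynomial σ K) w := by
  have h : ∀ i, ∃ w, (fun S => c S i) = contract (X : σ → MvPolynomial σ K) w := by
    intro i
    refine exists_contract_X_eq _ ?_ (h0 i)
    ext1 S
    rw [← contract_X_apply_coord, hc]; rfl
  choose w hw using h
  refine ⟨fun S i => w i S, ?_⟩
  ext1 S; ext1 i
  rw [contract_X_apply_coord]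
  exact congrFun (hw i) S

end KoszulExact

/-! ### Homogeneous components of integer degree. -/

section IntComponent

variable {σ K : Type*} [Field K]

/-- The homogeneous component of integer degree `e`, which is zero if `e` is negative. -/
noncomputable def intComponent (e : ℤ) : MvPolynomial σ K →ₗ[K] MvPolynomial σ K :=
  if 0 ≤ e then homogeneousComponent e.toNat else 0

theorem coeff_intComponent (e : ℤ) (p : MvPolynomial σ K) (s : σ →₀ ℕ) :
    coeff s (intComponent e p) = if (s.degree : ℤ) = e then coeff s p else 0 := by
  unfold intComponent
  split_ifs with h1 h2 h2
  · rw [coeff_homogeneousComponent, if_pos (by omega)]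
  · rw [coeff_homogeneousComponent, if_neg (by omega)]
  · omega
  · simp

theorem intComponent_natCast (n : ℕ) (p : MvPolynomial σ K) :
    intComponent (n : ℤ) p = homogeneousComponent n p := by
  simp [intComponent]

theorem intComponent_of_neg {e : ℤ} (he : e < 0) (p : MvPolynomial σ K) :
    intComponent e p = 0 := by
  simp [intComponent, not_le.2 he]

theorem IsHomogeneousOfIntDegree.coeff_eq_zero {p : MvPolynomial σ K} {e : ℤ}
    (hp : IsHomogeneousOfIntDegree p e) {s : σ →₀ ℕ} (hs : (s.degree : ℤ) ≠ e) :
    coeff s p = 0 := by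
  obtain rfl | ⟨d, hd, hp⟩ := hp
  · simp
  · exact hp.coeff_eq_zero (by omega)

theorem intComponent_mul {f : MvPolynomial σ K} {δ : ℤ} (hf : IsHomogeneousOfIntDegree f δ)
    (e : ℤ) (p : MvPolynomial σ K) : intComponent e (f * p) = f * intComponent (e - δ) p := by
  classical
  ext s
  rw [coeff_intComponent, coeff_mul, coeff_mul]
  have h : ∀ x ∈ Finset.HasAntidiagonal.antidiagonal s, coeff x.1 f * coeff x.2 (intComponent (e - δ) p) =
      if (s.degree : ℤ) = e then coeff x.1 f * coeff x.2 p else 0 := by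
    rintro ⟨u, v⟩ huv
    rw [Finset.HasAntidiagonal.mem_antidiagonal] at huv
    subst huv
    rw [coeff_intComponent, map_add]
    push_cast
    by_cases hu : (u.degree : ℤ) = δ
    · split_ifs <;> first | rfl | omega | simp
    · simp [hf.coeff_eq_zero hu]
  rw [Finset.sum_congr rfl h]
  split_ifs <;> simp

theorem intComponent_X_mul (a : σ) (e : ℤ) (p : MvPolynomial σ K) :
    intComponent e (X a * p) = X a * intComponent (e - 1) p :=
  intComponent_mul (Or.inr ⟨1, rfl, isHomogeneous_X K a⟩) e p

theorem intComponent_one_self : intComponent 0 (1 : MvPolynomial σ K) = 1 := by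
  have := intComponent_natCast 0 (1 : MvPolynomial σ K)
  rw [homogeneousComponent_zero] at this
  simpa using this

theorem coeff_zero_of_mem_span_X {p : MvPolynomial σ K}
    (hp : p ∈ Ideal.span (Set.range (X : σ → MvPolynomial σ K))) : coeff 0 p = 0 := by
  have h : Ideal.span (Set.range (X : σ → MvPolynomial σ K)) ≤
      RingHom.ker (constantCoeff : MvPolynomial σ K →+* K) := by
    rw [Ideal.span_le]
    rintro _ ⟨a, rfl⟩
    simp [RingHom.mem_ker]
  exact h hp

end IntComponent

/-! ### Koszul homology and the generators of a minimal resolution. -/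

namespace MinimalFreeResolution

variable {σ K : Type*} [Field K] {I : Ideal (MvPolynomial σ K)} (F : MinimalFreeResolution I)

theorem coeff_zero_φ_mulVec (k : ℕ) (y : Fin (F.rank (k + 1)) → MvPolynomial σ K)
    (i : Fin (F.rank k)) : coeff 0 ((F.φ k).mulVec y i) = 0 := by
  rw [Matrix.mulVec, dotProduct, coeff_sum]
  refine Finset.sum_eq_zero fun l _ => ?_
  change constantCoeff (F.φ k i l * y l) = 0
  rw [map_mul]
  have : constantCoeff (F.φ k i l) = 0 := coeff_zero_of_mem_span_X (F.minimal k i l)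
  rw [this, zero_mul]

theorem exists_of_φ_mulVec_eq_zero {k : ℕ} {y : Fin (F.rank (k + 1)) → MvPolynomial σ K}
    (h : (F.φ k).mulVec y = 0) : ∃ v, y = (F.φ (k + 1)).mulVec v := by
  obtain ⟨v, hv⟩ := (F.exact k y).1 (by simpa using h)
  exact ⟨v, by simpa using hv.symm⟩

theorem φ_mulVec_φ_mulVec (k : ℕ) (v : Fin (F.rank (k + 2)) → MvPolynomial σ K) :
    (F.φ k).mulVec ((F.φ (k + 1)).mulVec v) = 0 := by
  simpa using (F.exact k ((F.φ (k + 1)).mulVec v)).2 ⟨v, by simp⟩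

theorem φ_mul_φ (k : ℕ) : F.φ k * F.φ (k + 1) = 0 := by
  ext1 i j
  have h := congrFun (F.φ_mulVec_φ_mulVec k (Pi.single j 1)) i
  rw [Matrix.mulVec_mulVec, Matrix.mulVec_single_one] at h
  exact h

/-- By minimality no nonzero constant vector is a cycle. -/
theorem eq_zero_of_φ_mulVec_C_eq_zero {k : ℕ} {u : Fin (F.rank (k + 1)) → K}
    (h : (F.φ k).mulVec (fun l => C (u l)) = 0) : u = 0 := by
  obtain ⟨v, hv⟩ := F.exists_of_φ_mulVec_eq_zero h
  ext l
  have h1 := F.coeff_zero_φ_mulVec (k + 1) v l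
  rw [← hv] at h1
  simpa using h1

section Tor

/-- The component of total degree `d` and exterior degree `j` of an element of `F_k ⊗ Λ`. -/
noncomputable def component (k j : ℕ) (d : ℤ)
    (c : Finset σ → (Fin (F.rank k) → MvPolynomial σ K)) :
    Finset σ → (Fin (F.rank k) → MvPolynomial σ K) :=
  -- Wedge generators have degree one and the basis vector `i` has degree `F.deg k i`; the
  -- polynomial coefficient carries the rest of `d`.
  fun S i => if S.card = j then intComponent (d - j - F.deg k i) (c S i) else 0

theorem component_φ (k j : ℕ) (d : ℤ)
    (y : Finset σ → (Fin (F.rank (k + 1)) → MvPolynomial σ K)) :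
    F.component k j d (fun S => (F.φ k).mulVec (y S)) =
      fun S => (F.φ k).mulVec (F.component (k + 1) j d y S) := by
  ext1 S; ext1 i
  simp only [component, Matrix.mulVec, dotProduct]
  split_ifs with h
  · rw [map_sum]
    refine Finset.sum_congr rfl fun l _ => ?_
    rw [intComponent_mul (F.φ_graded k i l)]
    congr 2
    ring_nf
  · simp

variable [LinearOrder σ] [Fintype σ]

theorem component_contract (k j : ℕ) (d : ℤ)
    (c : Finset σ → (Fin (F.rank k) → MvPolynomial σ K)) :
    F.component k j d (contract (X : σ → MvPolynomial σ K) c) =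
      contract (X : σ → MvPolynomial σ K) (F.component k (j + 1) d c) := by
  ext1 S; ext1 i
  rw [contract_apply_apply]
  simp only [component, contract_apply_apply, Finset.sum_apply, Pi.smul_apply, smul_eq_mul]
  have h1 : ∀ b, contractBasis b (F.component k (j + 1) d c) S i = if S.card = j then
      intComponent (d - j - F.deg k i - 1) (contractBasis b c S i) else 0 := by
    intro b
    rw [contractBasis_apply, contractBasis_apply]
    by_cases hb : b ∈ S
    · simp [hb]
    · simp only [hb, if_false, Pi.smul_apply, component, Finset.card_insert_of_notMem hb,
        add_left_inj]
      split_ifs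
      · rw [map_zsmul]
        congr 3
        push_cast; ring
      · simp
  split_ifs with h
  · rw [map_sum]
    refine Finset.sum_congr rfl fun b _ => ?_
    rw [intComponent_X_mul]
    congr 1
    have := h1 b
    rw [if_pos h] at this
    exact this.symm
  · refine (Finset.sum_eq_zero fun b _ => ?_).symm
    have := h1 b
    rw [if_neg h] at this
    exact mul_eq_zero_of_right _ this

theorem contract_φ (k : ℕ) (y : Finset σ → (Fin (F.rank (k + 1)) → MvPolynomial σ K)) :
    contract (X : σ → MvPolynomial σ K) (fun S => (F.φ k).mulVec (y S)) =
      fun S => (F.φ k).mulVec (contract (X : σ → MvPolynomial σ K) y S) :=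
  contract_map (F.φ k).mulVecLin X y

/-- The vanishing in degree `d` of the `j`-th Koszul homology of the cokernel of the differential
`F_{k+1} → F_k`. -/
def KoszulVanish (k j : ℕ) (d : ℤ) : Prop :=
  ∀ c : Finset σ → (Fin (F.rank k) → MvPolynomial σ K),
    (∃ y : Finset σ → (Fin (F.rank (k + 1)) → MvPolynomial σ K),
      contract (X : σ → MvPolynomial σ K) c = fun S => (F.φ k).mulVec (y S)) →
    ∃ (w : Finset σ → (Fin (F.rank k) → MvPolynomial σ K))
      (v : Finset σ → (Fin (F.rank (k + 1)) → MvPolynomial σ K)),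
      F.component k j d c =
        contract (X : σ → MvPolynomial σ K) w + fun S => (F.φ k).mulVec (v S)

variable {F}

/-- Dimension shift. Minimality puts the entries of φ c into the maximal ideal, so the Koszul cycle
φ c is a boundary ∂b. The element b is a cycle modulo the image of φ; in degree `d` it becomes ∂w +
φ v, and then c - ∂v is killed by φ, hence comes from the next module. -/
theorem KoszulVanish.succ {k j : ℕ} {d : ℤ} (h : F.KoszulVanish k (j + 1) d) :
    F.KoszulVanish (k + 1) j d := by
  rintro c ⟨y, hy⟩
  have h1 : contract (X : σ → MvPolynomial σ K) (fun S => (F.φ k).mulVec (c S)) = 0 := by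
    rw [contract_φ, hy]
    ext1 S
    exact F.φ_mulVec_φ_mulVec k _
  obtain ⟨b, hb⟩ := exists_contract_X_eq_pi _ h1 fun i => F.coeff_zero_φ_mulVec k _ i
  obtain ⟨w, v, hwv⟩ := h b ⟨c, hb.symm⟩
  have h2 : ∀ S, (F.φ k).mulVec ((F.component (k + 1) j d c -
      contract (X : σ → MvPolynomial σ K) v) S) = 0 := by
    intro S
    have h3 := congrFun (F.component_φ k j d c) S
    have h4 := congrFun (F.contract_φ k v) S
    rw [hb, component_contract, hwv, map_add, contract_contract, zero_add, h4] at h3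
    rw [Pi.sub_apply, Matrix.mulVec_sub, h3, sub_self]
  choose z hz using fun S => F.exists_of_φ_mulVec_eq_zero (h2 S)
  refine ⟨v, z, ?_⟩
  rw [← sub_eq_iff_eq_add']
  ext1 S
  exact hz S

/-- The reverse shift: if ∂c = φ y, the hypothesis applied to y provides a w for which c - φ w is a
Koszul cycle in degree `d`. In positive exterior degree there is no component at `∅`, so this cycle
is a boundary. -/
theorem KoszulVanish.of_succ {k j : ℕ} {d : ℤ} (h : F.KoszulVanish (k + 1) j d) :
    F.KoszulVanish k (j + 1) d := by
  rintro c ⟨y, hy⟩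
  have h1 : ∀ S, (F.φ k).mulVec (contract (X : σ → MvPolynomial σ K) y S) = 0 := by
    intro S
    rw [← congrFun (F.contract_φ k y) S, ← hy, contract_contract]; rfl
  choose z hz using fun S => F.exists_of_φ_mulVec_eq_zero (h1 S)
  obtain ⟨w, v, hwv⟩ := h y ⟨z, funext hz⟩
  have h2 : contract (X : σ → MvPolynomial σ K)
      (F.component k (j + 1) d c - fun S => (F.φ k).mulVec (w S)) = 0 := by
    rw [map_sub, ← component_contract, hy, component_φ, contract_φ, hwv]
    ext1 S
    simp only [Pi.sub_apply, Pi.add_apply, Matrix.mulVec_add, φ_mulVec_φ_mulVec, add_zero, sub_self,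
      Pi.zero_apply]
  obtain ⟨u, hu⟩ := exists_contract_X_eq_pi _ h2 fun i => by
    simp only [Pi.sub_apply, coeff_sub, coeff_zero_φ_mulVec, sub_zero]
    simp [component]
  exact ⟨u, w, sub_eq_iff_eq_add.1 hu⟩

theorem KoszulVanish.of_zero {k j : ℕ} {d : ℤ} (h : F.KoszulVanish 0 (k + j) d) :
    F.KoszulVanish k j d := by
  induction k generalizing j with
  | zero => simpa using h
  | succ k ih => exact (ih (j := j + 1) (by rwa [← add_assoc, add_right_comm])).succ

theorem KoszulVanish.to_zero {k j : ℕ} {d : ℤ} (h : F.KoszulVanish k j d) :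
    F.KoszulVanish 0 (k + j) d := by
  induction k generalizing j with
  | zero => simpa using h
  | succ k ih =>
    have := ih h.of_succ
    rwa [← add_assoc, add_right_comm] at this

/-- If `Tor_k` vanishes in degree `d`, then `F_k` has no generator of degree `d`. -/
theorem KoszulVanish.deg_ne {k : ℕ} {d : ℤ} (h : F.KoszulVanish 0 k d) (i : Fin (F.rank k)) :
    F.deg k i ≠ d := by
  rintro rfl
  -- The basis vector `i` itself is a cycle of exterior degree zero. Koszul boundaries and the image
  -- of φ have no constant terms, but this vector has constant term one.
  obtain ⟨w, v, hwv⟩ := (show F.KoszulVanish 0 (k + 0) _ from h).of_zero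
    (fun S => if S = ∅ then Pi.single i 1 else 0) ⟨0, by
      ext1 S
      rw [contract_apply_apply]
      simp [contractBasis_apply]⟩
  have h1 := congrArg (coeff 0) (congrFun (congrFun hwv ∅) i)
  simp only [Pi.add_apply, coeff_add, coeff_zero_contract_X, coeff_zero_φ_mulVec, component] at h1
  simp [intComponent_one_self] at h1

/-- If `F_k` vanishes, then so does `Tor_k`. -/
theorem KoszulVanish.of_rank_eq_zero {k : ℕ} (h : F.rank k = 0) (d : ℤ) :
    F.KoszulVanish 0 k d := by
  have : F.KoszulVanish k 0 d := by
    rintro c -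
    have : IsEmpty (Fin (F.rank k)) := by rw [h]; infer_instance
    exact ⟨0, 0, by ext1 S; exact Subsingleton.elim _ _⟩
  exact this.to_zero

end Tor

end MinimalFreeResolution

/-! ### The ideal of the standard points and Koszul cycles modulo it. -/

section Points

variable {K : Type*} [Field K]

theorem MvPolynomial.IsHomogeneous.aeval_mul {σ B : Type*} [CommRing B] [Algebra K B]
    {p : MvPolynomial σ K} {n : ℕ} (hp : p.IsHomogeneous n) (t : B) (g : σ → B) :
    MvPolynomial.aeval (fun i => t * g i) p = t ^ n * MvPolynomial.aeval g p := by
  rw [MvPolynomial.aeval_def, MvPolynomial.aeval_def, eval₂_eq, eval₂_eq, Finset.mul_sum]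
  refine Finset.sum_congr rfl fun s hs => ?_
  have h : s.degree = n := by
    by_contra h
    exact (mem_support_iff.1 hs) (hp.coeff_eq_zero h)
  simp only [mul_pow, Finset.prod_mul_distrib]
  rw [Finset.prod_pow_eq_pow_sum]
  have : ∑ i ∈ s.support, s i = n := h
  rw [this]
  ring

theorem MvPolynomial.IsHomogeneous.eval_smul {σ : Type*} {p : MvPolynomial σ K} {n : ℕ}
    (hp : p.IsHomogeneous n) (t : K) (g : σ → K) : eval (t • g) p = t ^ n * eval g p := by
  have := hp.aeval_mul t g
  simpa only [aeval_eq_eval, Pi.smul_def, smul_eq_mul] using this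

/-- A homogeneous polynomial of degree one is determined by its values on the standard basis. -/
theorem MvPolynomial.IsHomogeneous.eq_sum_X {σ : Type*} [Fintype σ] [DecidableEq σ]
    {p : MvPolynomial σ K} (hp : p.IsHomogeneous 1) :
    p = ∑ i, C (eval (Pi.single i 1) p) * X i := by
  have h : p ∈ Submodule.span K (Set.range (X : σ → MvPolynomial σ K)) := by
    rw [← homogeneousSubmodule_one_eq_span_X]; exact hp
  induction h using Submodule.span_induction with
  | mem x hx =>
    obtain ⟨a, rfl⟩ := hx
    simp [Pi.single_apply]
  | zero => simp
  | add x y _ _ hx hy =>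
    rw [homogeneousSubmodule_one_eq_span_X.symm] at *
    conv_lhs => rw [hx ‹_›, hy ‹_›]
    simp [add_mul, Finset.sum_add_distrib]
  | smul a x _ hx =>
    rw [homogeneousSubmodule_one_eq_span_X.symm] at *
    conv_lhs => rw [hx ‹_›]
    simp [smul_eq_C_mul, Finset.mul_sum, mul_assoc]

/-- Representatives of the standard points. -/
def standardVector (K : Type*) [Field K] (m : ℕ) : Option (Fin (m + 1)) → Fin (m + 1) → K
  | none => 1
  | some i => Pi.single i 1

theorem standardVector_ne_zero {m : ℕ} (o : Option (Fin (m + 1))) : standardVector K m o ≠ 0 := by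
  cases o with
  | none => exact one_ne_zero
  | some i => simp [standardVector]

theorem mem_standardPoints {m : ℕ} {P : Projectivization K (Fin (m + 1) → K)} :
    P ∈ standardPoints K m ↔
      ∃ o, P = Projectivization.mk K (standardVector K m o) (standardVector_ne_zero o) := by
  rw [standardPoints, Set.mem_ofPred_eq, Option.exists]
  exact or_comm

theorem eval_rep_eq_zero_iff {σ : Type*} {p : MvPolynomial σ K} {n : ℕ} (hp : p.IsHomogeneous n)
    (v : σ → K) (hv : v ≠ 0) : eval (Projectivization.mk K v hv).rep p = 0 ↔ eval v p = 0 := by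
  obtain ⟨a, ha⟩ := Projectivization.exists_smul_eq_mk_rep K v hv
  rw [← ha, Units.smul_def, hp.eval_smul]
  simp

theorem mem_projVanishingIdeal_iff {m n : ℕ} {p : MvPolynomial (Fin (m + 1)) K}
    (hp : p.IsHomogeneous n) :
    p ∈ projVanishingIdeal (standardPoints K m) ↔ ∀ o, eval (standardVector K m o) p = 0 := by
  constructor
  · intro h o
    -- Substituting T·v, with T an indeterminate, turns a form of degree d into its value at v times
    -- T^d. The generators of the ideal go to zero, so `p` does as well.
    set f := MvPolynomial.aeval (R := K)
      (fun i => (Polynomial.X : Polynomial K) * Polynomial.C (standardVector K m o i))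
    have hC : ∀ q : MvPolynomial (Fin (m + 1)) K,
        MvPolynomial.aeval (R := K) (fun i => Polynomial.C (standardVector K m o i)) q =
          Polynomial.C (eval (standardVector K m o) q) := by
      intro q
      rw [← aeval_eq_eval, ← Polynomial.algebraMap_eq]
      exact (MvPolynomial.aeval_algebraMap_apply _ _ _)
    have h1 : projVanishingIdeal (standardPoints K m) ≤ RingHom.ker f := by
      unfold projVanishingIdeal
      rw [Ideal.span_le]
      rintro q ⟨⟨d, hq⟩, hq0⟩
      have h2 := hq0 _ (mem_standardPoints.2 ⟨o, rfl⟩)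
      rw [eval_rep_eq_zero_iff hq] at h2
      rw [SetLike.mem_coe, RingHom.mem_ker, hq.aeval_mul, hC, h2]
      simp
    have h3 : f p = 0 := h1 h
    rw [hp.aeval_mul, hC] at h3
    simpa using h3
  · intro h
    refine Ideal.subset_span ⟨⟨n, hp⟩, fun P hP => ?_⟩
    obtain ⟨o, rfl⟩ := mem_standardPoints.1 hP
    rw [eval_rep_eq_zero_iff hp]
    exact h o

theorem coeff_zero_of_mem_projVanishingIdeal {m : ℕ} {p : MvPolynomial (Fin (m + 1)) K}
    (hp : p ∈ projVanishingIdeal (standardPoints K m)) : coeff 0 p = 0 := by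
  have h : projVanishingIdeal (standardPoints K m) ≤
      RingHom.ker (constantCoeff : MvPolynomial (Fin (m + 1)) K →+* K) := by
    unfold projVanishingIdeal
    rw [Ideal.span_le]
    rintro q ⟨⟨d, hq⟩, hq0⟩
    have h2 := hq0 _ (mem_standardPoints.2 ⟨none, rfl⟩)
    rw [eval_rep_eq_zero_iff hq] at h2
    rw [SetLike.mem_coe, RingHom.mem_ker]
    by_cases hd : d = 0
    · subst hd
      rw [← totalDegree_zero_iff_isHomogeneous] at hq
      rw [totalDegree_eq_zero_iff_eq_C.1 hq] at h2 ⊢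
      simpa using h2
    · exact hq.coeff_eq_zero (by simpa using Ne.symm hd)
  exact h hp

section KoszulPoints

variable {m : ℕ}

theorem contract_X_isHomogeneous {n : ℕ} {w : Finset (Fin (m + 1)) → MvPolynomial (Fin (m + 1)) K}
    (hw : ∀ S, (w S).IsHomogeneous n) (S : Finset (Fin (m + 1))) :
    (contract (X : Fin (m + 1) → MvPolynomial (Fin (m + 1)) K) w S).IsHomogeneous (n + 1) := by
  rw [contract_apply_apply]
  refine IsHomogeneous.sum _ _ _ fun b _ => ?_
  rw [contractBasis_apply, add_comm n 1, smul_eq_mul]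
  refine (isHomogeneous_X K b).mul ?_
  split_ifs
  · exact isHomogeneous_zero _ _ _
  · exact (homogeneousSubmodule (Fin (m + 1)) K n).toAddSubgroup.zsmul_mem (hw _) _

theorem contract_single (i : Fin (m + 1)) (c : Finset (Fin (m + 1)) → K) :
    contract (Pi.single i (1 : K)) c = contractBasis i c := by
  rw [contract_apply, Finset.sum_eq_single i] <;> simp +contextual

theorem eval_contract_X (v : Fin (m + 1) → K)
    (w : Finset (Fin (m + 1)) → MvPolynomial (Fin (m + 1)) K) (S : Finset (Fin (m + 1))) :
    eval v (contract (X : Fin (m + 1) → MvPolynomial (Fin (m + 1)) K) w S) =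
      contract v (fun T => eval v (w T)) S := by
  have := congrFun (contract_map_ringHom (eval v) X w) S
  simpa using this.symm

/-- Reduces being a boundary modulo the ideal to linear algebra over `K`: only the values of `w` at
the standard vectors matter. -/
theorem sub_contract_mem {n : ℕ} {c w : Finset (Fin (m + 1)) → MvPolynomial (Fin (m + 1)) K}
    (hc : ∀ S, (c S).IsHomogeneous (n + 1)) (hw : ∀ S, (w S).IsHomogeneous n)
    (h : ∀ o, contract (standardVector K m o) (fun T => eval (standardVector K m o) (w T)) =
      fun T => eval (standardVector K m o) (c T)) (S : Finset (Fin (m + 1))) :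
    c S - contract (X : Fin (m + 1) → MvPolynomial (Fin (m + 1)) K) w S ∈
      projVanishingIdeal (standardPoints K m) := by
  rw [mem_projVanishingIdeal_iff ((hc S).sub (contract_X_isHomogeneous hw S))]
  intro o
  rw [map_sub, eval_contract_X, h, sub_self]

/-- A coordinate at which the standard vector has the value one. -/
def standardPivot (m : ℕ) : Option (Fin (m + 1)) → Fin (m + 1)
  | none => 0
  | some i => i

theorem standardVector_pivot (o : Option (Fin (m + 1))) :
    standardVector K m o (standardPivot m o) = 1 := by
  cases o <;> simp [standardVector, standardPivot]

variable {n k : ℕ} {c : Finset (Fin (m + 1)) → MvPolynomial (Fin (m + 1)) K}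

theorem contract_eval_eq_zero (hc : ∀ S, (c S).IsHomogeneous n)
    (hI : ∀ S, contract (X : Fin (m + 1) → MvPolynomial (Fin (m + 1)) K) c S ∈
      projVanishingIdeal (standardPoints K m)) (o : Option (Fin (m + 1))) :
    contract (standardVector K m o) (fun T => eval (standardVector K m o) (c T)) = 0 := by
  ext1 S
  rw [← eval_contract_X]
  exact (mem_projVanishingIdeal_iff (contract_X_isHomogeneous hc S)).1 (hI S) o

/-- At a single point the Koszul complex is contracted by wedging with the pivot coordinate, so the
values of a cycle modulo the ideal are boundaries with an explicit preimage. -/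
theorem contract_wedgeBasis_eval (hc : ∀ S, (c S).IsHomogeneous n)
    (hI : ∀ S, contract (X : Fin (m + 1) → MvPolynomial (Fin (m + 1)) K) c S ∈
      projVanishingIdeal (standardPoints K m)) (o : Option (Fin (m + 1))) :
    contract (standardVector K m o) (wedgeBasis (standardPivot m o)
      (fun T => eval (standardVector K m o) (c T))) =
      fun T => eval (standardVector K m o) (c T) := by
  have := contract_wedgeBasis (standardVector K m o) (standardPivot m o)
    (fun T => eval (standardVector K m o) (c T))
  rwa [contract_eval_eq_zero hc hI, map_zero, add_zero, standardVector_pivot, one_smul] at this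

theorem wedgeBasis_eq_zero_of_card {a : Fin (m + 1)} {d : Finset (Fin (m + 1)) → K}
    (hd : ∀ S, S.card ≠ k → d S = 0) {S : Finset (Fin (m + 1))} (hS : S.card ≠ k + 1) :
    wedgeBasis a d S = 0 := by
  rw [wedgeBasis_apply]
  split_ifs with h
  · rw [hd, smul_zero]
    rw [Finset.card_erase_of_mem h]
    have := Finset.card_pos.2 ⟨a, h⟩
    omega
  · rfl

/-- From degree two on, the points impose independent conditions on forms. A product of powers of
two distinct variables vanishes at all unit vectors and is 1 at the all-ones vector; subtracting it
from a pure power removes the value of the latter there. -/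
theorem exists_interpolation (hm : 1 ≤ m) (n : ℕ) (hn : 2 ≤ n) :
    ∃ g : Option (Fin (m + 1)) → MvPolynomial (Fin (m + 1)) K, (∀ o, (g o).IsHomogeneous n) ∧
      ∀ o o', eval (standardVector K m o) (g o') = if o = o' then 1 else 0 := by
  have : Nontrivial (Fin (m + 1)) := Fin.nontrivial_iff_two_le.2 (by omega)
  choose f hf using fun i : Fin (m + 1) => exists_ne i
  have hh : ∀ a b : Fin (m + 1), (X a ^ (n - 1) * X b : MvPolynomial (Fin (m + 1)) K).IsHomogeneous
      n := by
    intro a b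
    have := ((isHomogeneous_X K a).pow (n - 1)).mul (isHomogeneous_X K b)
    rwa [one_mul, Nat.sub_add_cancel (by omega)] at this
  refine ⟨fun o => o.elim (X 0 ^ (n - 1) * X (f 0)) fun i =>
    X i ^ (n - 1) * X i - X i ^ (n - 1) * X (f i), ?_, ?_⟩
  · rintro (_ | i)
    · exact hh _ _
    · exact (hh _ _).sub (hh _ _)
  · have h0 : n - 1 ≠ 0 := by omega
    have hz : ∀ i j a : Fin (m + 1), a ≠ j →
        (Pi.single i 1 : Fin (m + 1) → K) a ^ (n - 1) * (Pi.single i 1 : Fin (m + 1) → K) j = 0 := by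
      intro i j a haj
      by_cases h : a = i
      · subst h; simp [haj.symm]
      · simp [h, h0]
    rintro (_ | i) (_ | j)
    · simp [standardVector]
    · simp [standardVector]
    · simp only [standardVector, Option.elim, map_mul, map_pow, eval_X, reduceCtorEq, if_false]
      exact hz _ _ _ (hf 0).symm
    · simp only [standardVector, Option.elim, map_mul, map_pow, map_sub, eval_X,
        Option.some.injEq]
      rw [hz _ _ _ (hf j).symm, sub_zero]
      by_cases h : i = j
      · subst h; simp
      · simp [h, Ne.symm h]

/-- The coefficients sought have degree at least two, so preimages can be prescribed at all points
independently. -/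
theorem koszul_boundary_of_two_lt (hm : 1 ≤ m) (hn : 2 ≤ n)
    (hc : ∀ S, (c S).IsHomogeneous (n + 1))
    (hI : ∀ S, contract (X : Fin (m + 1) → MvPolynomial (Fin (m + 1)) K) c S ∈
      projVanishingIdeal (standardPoints K m)) :
    ∃ w, ∀ S, c S - contract (X : Fin (m + 1) → MvPolynomial (Fin (m + 1)) K) w S ∈
      projVanishingIdeal (standardPoints K m) := by
  obtain ⟨g, hg, hge⟩ := exists_interpolation (K := K) hm n hn
  refine ⟨fun S => ∑ o, C (wedgeBasis (standardPivot m o)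
      (fun T => eval (standardVector K m o) (c T)) S) * g o, sub_contract_mem hc
      (fun S => IsHomogeneous.sum _ _ _ fun o _ => (hg o).C_mul _) fun o => ?_⟩
  simp only [map_sum, map_mul, eval_C, hge, mul_ite, mul_one, mul_zero, Finset.sum_ite_eq,
    Finset.mem_univ, if_true]
  exact contract_wedgeBasis_eval hc hI o

/-- The coefficients sought are linear forms: arbitrary at the unit vectors, with the sum of these
values at the all-ones vector. The defect `Y` must be distributed over the unit vectors without
changing the boundaries there. This is possible since `Y` vanishes on the full wedge monomial,
because `k < m`. -/
theorem koszul_boundary_of_two (hk : k < m) (hck : ∀ S, S.card ≠ k → c S = 0)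
    (hc : ∀ S, (c S).IsHomogeneous 2)
    (hI : ∀ S, contract (X : Fin (m + 1) → MvPolynomial (Fin (m + 1)) K) c S ∈
      projVanishingIdeal (standardPoints K m)) :
    ∃ w, ∀ S, c S - contract (X : Fin (m + 1) → MvPolynomial (Fin (m + 1)) K) w S ∈
      projVanishingIdeal (standardPoints K m) := by
  set y : Option (Fin (m + 1)) → Finset (Fin (m + 1)) → K := fun o =>
    wedgeBasis (standardPivot m o) (fun T => eval (standardVector K m o) (c T)) with hy
  set Y : Finset (Fin (m + 1)) → K := y none - ∑ i, y (some i) with hY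
  have hYu : Y Finset.univ = 0 := by
    have : ∀ o, y o Finset.univ = 0 := fun o =>
      wedgeBasis_eq_zero_of_card (k := k) (fun S hS => by rw [hck S hS, map_zero])
        (by rw [Finset.card_univ, Fintype.card_fin]; omega)
    simp [hY, Finset.sum_apply, this]
  have hf : ∀ S : Finset (Fin (m + 1)), ∃ i, S ≠ Finset.univ → i ∉ S := by
    intro S
    by_cases h : S = Finset.univ
    · exact ⟨0, fun h' => absurd h h'⟩
    · obtain ⟨i, hi⟩ : ∃ i, i ∉ S := by
        by_contra! h'
        exact h (Finset.eq_univ_iff_forall.2 h')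
      exact ⟨i, fun _ => hi⟩
  choose f hf using hf
  -- Each proper `S` has an index `f S` outside it, and `Y S` is assigned to that index. Then `z i`
  -- lives on sets not containing `i`, so contraction with `i` kills it.
  set z : Fin (m + 1) → Finset (Fin (m + 1)) → K := fun i S => if i = f S then Y S else 0 with hz
  have hz0 : ∀ i, contractBasis i (z i) = 0 := by
    intro i
    ext1 S
    rw [contractBasis_apply]
    split_ifs with h
    · rfl
    · by_cases hu : insert i S = Finset.univ
      · simp [hz, hu, hYu]
      · have h1 : i ≠ f (insert i S) := fun h1 => hf _ hu (h1 ▸ Finset.mem_insert_self i S)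
        simp [hz, h1]
  refine ⟨fun S => ∑ i, C (y (some i) S + z i S) * X i, sub_contract_mem hc
      (fun S => IsHomogeneous.sum _ _ _ fun o _ => isHomogeneous_C_mul_X _ _) fun o => ?_⟩
  rw [← contract_wedgeBasis_eval hc hI o]
  cases o with
  | none =>
    congr 1
    ext1 S
    simp only [map_sum, map_mul, eval_C, eval_X, standardVector, Pi.one_apply, mul_one]
    rw [Finset.sum_add_distrib, hz]
    simp only [Finset.sum_ite_eq', Finset.mem_univ, if_true, hY, Pi.sub_apply, Finset.sum_apply]
    rw [add_sub_cancel]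
    rfl
  | some i =>
    have h1 : (fun T => eval (standardVector K m (some i)) (∑ i, C (y (some i) T + z i T) * X i)) =
        y (some i) + z i := by
      ext1 S
      simp [standardVector, Pi.single_apply]
    rw [h1, map_add]
    have h2 := hz0 i
    rw [← contract_single] at h2
    change _ + contract (Pi.single i (1 : K)) (z i) = _
    rw [h2, add_zero]

/-- The cycle condition at the unit vectors makes the linear form at the complement of `i` a
multiple of `X i`. Its value at the i-th unit vector then equals its value at the all-ones vector,
so the scalar that works at the latter works everywhere. -/
theorem koszul_boundary_of_one (hck : ∀ S, S.card ≠ m → c S = 0)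
    (hc : ∀ S, (c S).IsHomogeneous 1)
    (hI : ∀ S, contract (X : Fin (m + 1) → MvPolynomial (Fin (m + 1)) K) c S ∈
      projVanishingIdeal (standardPoints K m)) :
    ∃ w, ∀ S, c S - contract (X : Fin (m + 1) → MvPolynomial (Fin (m + 1)) K) w S ∈
      projVanishingIdeal (standardPoints K m) := by
  set G : Finset (Fin (m + 1)) → K :=
    wedgeBasis 0 (fun T => eval (standardVector K m none) (c T)) with hG
  have hGn : contract (standardVector K m none) G = fun T => eval (standardVector K m none) (c T) :=
    contract_wedgeBasis_eval hc hI none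
  have hcard : ∀ S, S.card ≠ m + 1 → G S = 0 := fun S hS =>
    wedgeBasis_eq_zero_of_card (fun S hS => by rw [hck S hS, map_zero]) hS
  have h0 : ∀ i S, i ∈ S → eval (standardVector K m (some i)) (c S) = 0 := by
    intro i S hi
    have h1 := congrFun (contract_eval_eq_zero hc hI (some i)) (S.erase i)
    change contract (Pi.single i (1 : K)) _ _ = _ at h1
    rw [contract_single, contractBasis_apply, if_neg (by simp), Finset.insert_erase hi] at h1
    rw [← one_smul ℤ (eval _ _), ← wedgeSign_mul_self i (S.erase i), mul_smul, h1, Pi.zero_apply,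
      smul_zero]
  refine ⟨fun S => C (G S), sub_contract_mem (n := 0) hc (fun S => isHomogeneous_C _ _) fun o => ?_⟩
  simp only [eval_C]
  cases o with
  | none => exact hGn
  | some i =>
    change contract (Pi.single i (1 : K)) G = _
    rw [contract_single]
    ext1 S
    by_cases hi : i ∈ S
    · rw [h0 i S hi, contractBasis_apply, if_pos hi]
    by_cases hS : S.card = m
    · have hS' : ∀ b, b ≠ i → b ∈ S := by
        have : insert i S = Finset.univ := by
          rw [← Finset.card_eq_iff_eq_univ, Finset.card_insert_of_notMem hi, hS, Fintype.card_fin]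
        intro b hb
        have h := Finset.mem_univ b
        rw [← this, Finset.mem_insert] at h
        exact h.resolve_left hb
      have h1 := congrFun hGn S
      rw [contract_apply_apply, Finset.sum_eq_single i, (hc S).eq_sum_X] at h1
      · simp only [standardVector, Pi.one_apply, one_smul, map_sum, map_mul, eval_C, eval_X,
          mul_one] at h1
        rw [h1, Finset.sum_eq_single i]
        · rfl
        · exact fun b _ hb => h0 b S (hS' b hb)
        · simp
      · intro b _ hb
        rw [contractBasis_apply, if_pos (hS' b hb), smul_zero]
      · simp
    · rw [hck S hS, map_zero, contractBasis_apply, if_neg hi, hcard, smul_zero]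
      rw [Finset.card_insert_of_notMem hi]
      omega

/-- A linear form vanishing at all unit vectors is zero, so a constant cycle modulo the ideal is a
genuine Koszul cycle. -/
theorem koszul_boundary_of_zero (hk : k ≠ 0) (hck : ∀ S, S.card ≠ k → c S = 0)
    (hc : ∀ S, (c S).IsHomogeneous 0)
    (hI : ∀ S, contract (X : Fin (m + 1) → MvPolynomial (Fin (m + 1)) K) c S ∈
      projVanishingIdeal (standardPoints K m)) :
    ∃ w, ∀ S, c S - contract (X : Fin (m + 1) → MvPolynomial (Fin (m + 1)) K) w S ∈
      projVanishingIdeal (standardPoints K m) := by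
  have h1 : contract (X : Fin (m + 1) → MvPolynomial (Fin (m + 1)) K) c = 0 := by
    ext1 S
    have h2 := contract_X_isHomogeneous hc S
    rw [h2.eq_sum_X]
    refine Finset.sum_eq_zero fun i _ => ?_
    have := (mem_projVanishingIdeal_iff h2).1 (hI S) (some i)
    rw [standardVector] at this
    rw [this, map_zero, zero_mul]
  obtain ⟨w, hw⟩ := exists_contract_X_eq c h1 (by rw [hck ∅ (by simpa using hk.symm), coeff_zero])
  exact ⟨w, fun S => by rw [← hw, sub_self]; exact Ideal.zero_mem _⟩

end KoszulPoints

end Points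

/-! ### Ranks and degrees in the resolution of the standard points. -/

namespace MinimalFreeResolution

section RankZero

variable {σ K : Type*} [Field K] {I : Ideal (MvPolynomial σ K)} (F : MinimalFreeResolution I)

/-- If `I` lies in the maximal ideal, then `F_0` is free of rank one on a generator of degree
zero, and the image of `F_1` in it is `I`. -/
theorem exists_unique_generator (hI : ∀ p ∈ I, coeff 0 p = 0) :
    ∃ i₀ : Fin (F.rank 0), (∀ i, i = i₀) ∧ F.deg 0 i₀ = 0 ∧
      ∀ p, p ∈ I ↔ ∃ v, (F.φ 0).mulVec v i₀ = p := by
  choose p hp hpa using F.aug_graded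
  have haug : ∀ z : Fin (F.rank 0) → MvPolynomial σ K,
      F.aug z = Ideal.Quotient.mk I (∑ i, z i * p i) := by
    intro z
    conv_lhs => rw [pi_eq_sum_univ' z]
    rw [map_sum, map_sum]
    refine Finset.sum_congr rfl fun i _ => ?_
    rw [map_smul, hpa, map_mul]
    rfl
  have hker : ∀ z : Fin (F.rank 0) → MvPolynomial σ K,
      (∑ i, z i * p i) ∈ I ↔ ∃ v, (F.φ 0).mulVec v = z := by
    intro z
    rw [← Ideal.Quotient.eq_zero_iff_mem, ← haug, F.exact_aug z]
    rfl
  obtain ⟨z, hz⟩ := F.aug_surjective 1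
  rw [haug, ← map_one (Ideal.Quotient.mk I), Ideal.Quotient.eq] at hz
  -- Some combination of the `p i` is 1 modulo `I`, and `I` contains no polynomial with a constant
  -- term; hence one `p i` is a nonzero constant.
  have h1 : ∃ i, coeff 0 (p i) ≠ 0 := by
    by_contra! h
    have h2 := hI _ hz
    rw [coeff_sub, coeff_sum, Finset.sum_eq_zero] at h2
    · simp at h2
    · intro i _
      change constantCoeff (z i * p i) = 0
      rw [map_mul, constantCoeff_eq, h, mul_zero]
  obtain ⟨i, hi⟩ := h1
  have hdeg : F.deg 0 i = 0 := by
    by_contra h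
    exact hi ((hp i).coeff_eq_zero (by simpa using Ne.symm h))
  obtain ⟨u, hu0, hu⟩ : ∃ u : K, u ≠ 0 ∧ p i = C u := by
    refine ⟨coeff 0 (p i), hi, ?_⟩
    rcases hp i with h | ⟨d, hd, h⟩
    · simp [h]
    · obtain rfl : d = 0 := by omega
      rw [← totalDegree_zero_iff_isHomogeneous] at h
      exact totalDegree_eq_zero_iff_eq_C.1 h
  have huniq : ∀ j, j = i := by
    intro j
    by_contra hj
    -- A second generator `j` would give an element of the kernel of the augmentation with entry 1
    -- at `j`, against minimality.
    obtain ⟨v, hv⟩ := (hker (Pi.single j 1 - Pi.single i (C u⁻¹ * p j))).1 (by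
      have : ∑ l, (Pi.single j 1 - Pi.single i (C u⁻¹ * p j) : Fin (F.rank 0) → _) l * p l = 0 := by
        simp only [Pi.sub_apply, sub_mul, Finset.sum_sub_distrib, Pi.single_apply, ite_mul, one_mul,
          zero_mul, Finset.sum_ite_eq', Finset.mem_univ, if_true, hu]
        rw [mul_right_comm, ← C_mul, inv_mul_cancel₀ hu0, C_1, one_mul, sub_self]
      rw [this]; exact I.zero_mem)
    have h2 := F.coeff_zero_φ_mulVec 0 v j
    rw [hv] at h2
    simp [hj] at h2
  refine ⟨i, huniq, hdeg, fun q => ?_⟩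
  have hq : ∑ l, (fun _ : Fin (F.rank 0) => q) l * p l = C u * q := by
    rw [Finset.sum_eq_single i, hu, mul_comm]
    · exact fun l _ hl => absurd (huniq l) hl
    · simp
  have hq' : q ∈ I ↔ C u * q ∈ I := by
    refine ⟨fun h => I.mul_mem_left _ h, fun h => ?_⟩
    have := I.mul_mem_left (C u⁻¹) h
    rwa [← mul_assoc, ← C_mul, inv_mul_cancel₀ hu0, C_1, one_mul] at this
  rw [hq', ← hq, hker]
  refine exists_congr fun v => ⟨fun h => congrFun h i, fun h => ?_⟩
  ext1 l
  rw [huniq l, h]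

end RankZero

section Standard

variable {K : Type*} [Field K] {m : ℕ}
  (F : MinimalFreeResolution (projVanishingIdeal (standardPoints K m)))

/-- In terms of the polynomial degree n = d - k of the chains, the cases are n < 0, n = 0 with k ≠
0, n ≥ 3, n = 2 for k < m, and n = 1 for k = m. For 0 < k only n = 1 below m and n = 2 at m are left
open. -/
theorem koszulVanish (hm : 1 ≤ m) {k : ℕ} {d : ℤ} (h : d < k ∨ (d = k ∧ k ≠ 0) ∨ (k : ℤ) + 3 ≤ d ∨
    (d = k + 2 ∧ k < m) ∨ (d = k + 1 ∧ k = m)) : F.KoszulVanish 0 k d := by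
  rintro c ⟨y, hy⟩
  obtain ⟨i₀, huniq, hdeg, hmem⟩ :=
    F.exists_unique_generator fun p hp => coeff_zero_of_mem_projVanishingIdeal hp
  by_cases hdk : d < k
  · refine ⟨0, 0, ?_⟩
    ext1 S; ext1 i
    rw [huniq i]
    simp only [component, hdeg]
    split_ifs
    · rw [intComponent_of_neg (by omega)]
      simp
    · simp
  obtain ⟨n, rfl⟩ : ∃ n : ℕ, d = k + n := ⟨(d - k).toNat, by omega⟩
  set b := F.component 0 k (k + n) c with hb
  set c' : Finset (Fin (m + 1)) → MvPolynomial (Fin (m + 1)) K := fun S => b S i₀ with hc'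
  have hck : ∀ S, S.card ≠ k → c' S = 0 := fun S hS => if_neg hS
  have hc : ∀ S, (c' S).IsHomogeneous n := by
    intro S
    by_cases hS : S.card = k
    · have : c' S = homogeneousComponent n (c S i₀) := by
        simp only [hc', hb, component, if_pos hS, hdeg]
        rw [← intComponent_natCast]
        congr 2; ring
      rw [this]
      exact homogeneousComponent_isHomogeneous _ _
    · rw [hck S hS]; exact isHomogeneous_zero _ _ _
  have hI : ∀ S, contract (X : Fin (m + 1) → MvPolynomial (Fin (m + 1)) K) c' S ∈
      projVanishingIdeal (standardPoints K m) := by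
    intro S
    cases k with
    | zero =>
      rw [contract_apply_apply, Finset.sum_eq_zero]
      · exact Ideal.zero_mem _
      · intro a _
        rw [contractBasis_apply]
        split_ifs with ha
        · simp
        · rw [hck _ (by simp [Finset.card_insert_of_notMem ha]), smul_zero, smul_zero]
    | succ j =>
      rw [← contract_X_apply_coord, hb, ← component_contract, hy, component_φ, hmem]
      exact ⟨_, rfl⟩
  have key : ∃ w, ∀ S, c' S - contract (X : Fin (m + 1) → MvPolynomial (Fin (m + 1)) K) w S ∈
      projVanishingIdeal (standardPoints K m) := by
    rcases h with h | h | h | h | h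
    · omega
    · obtain rfl : n = 0 := by omega
      exact koszul_boundary_of_zero h.2 hck hc hI
    · obtain ⟨n, rfl⟩ : ∃ n', n = n' + 1 := ⟨n - 1, by omega⟩
      exact koszul_boundary_of_two_lt hm (by omega) hc hI
    · obtain rfl : n = 2 := by omega
      exact koszul_boundary_of_two h.2 hck hc hI
    · obtain ⟨h, rfl⟩ := h
      obtain rfl : n = 1 := by omega
      exact koszul_boundary_of_one hck hc hI
  obtain ⟨w, hw⟩ := key
  choose v hv using fun S => (hmem _).1 (hw S)
  refine ⟨fun S _ => w S, v, ?_⟩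
  ext1 S; ext1 i
  rw [huniq i, Pi.add_apply, Pi.add_apply, hv, contract_X_apply_coord]
  simp [hc']

theorem deg_eq_of_lt (hm : 1 ≤ m) {k : ℕ} (hk : k ≠ 0) (hkm : k < m) (i : Fin (F.rank k)) :
    F.deg k i = k + 1 := by
  by_contra h
  refine (F.koszulVanish hm (k := k) (d := F.deg k i) ?_).deg_ne i rfl
  omega

theorem deg_eq_last (hm : 1 ≤ m) (i : Fin (F.rank m)) : F.deg m i = m + 2 := by
  by_contra h
  refine (F.koszulVanish hm (k := m) (d := F.deg m i) ?_).deg_ne i rfl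
  omega

/-- A nonzero class: the quadric `X 0 * X (Fin.last m)` times the contraction of the full wedge
monomial with the all-ones vector. It vanishes at the unit vectors and is a cycle at the all-ones
vector. Bounding it would take a linear form that is zero at every unit vector but 1 at the all-ones
vector. -/
theorem rank_last_ne_zero (hm : 1 ≤ m) : F.rank m ≠ 0 := by
  intro h0
  have h := KoszulVanish.of_rank_eq_zero h0 (m + 2)
  obtain ⟨i₀, huniq, hdeg, hmem⟩ :=
    F.exists_unique_generator fun p hp => coeff_zero_of_mem_projVanishingIdeal hp
  have h01 : (0 : Fin (m + 1)) ≠ Fin.last m := by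
    rw [Ne, Fin.ext_iff]; simp; omega
  set q : MvPolynomial (Fin (m + 1)) K := X 0 * X (Fin.last m) with hq
  have hqh : q.IsHomogeneous 2 := (isHomogeneous_X K _).mul (isHomogeneous_X K _)
  set e : Finset (Fin (m + 1)) → K := fun S => if S = Finset.univ then 1 else 0 with he
  set c : Finset (Fin (m + 1)) → MvPolynomial (Fin (m + 1)) K :=
    fun S => C (contract (1 : Fin (m + 1) → K) e S) * q with hc
  have hch : ∀ S, (c S).IsHomogeneous 2 := fun S => hqh.C_mul _
  have hqs : ∀ i, eval (Pi.single i 1) q = 0 := by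
    intro i
    simp only [hq, map_mul, eval_X]
    by_cases h : i = 0
    · subst h; simp [h01]
    · simp [Ne.symm h]
  have hck : ∀ S, S.card ≠ m → c S = 0 := by
    intro S hS
    have : contract (1 : Fin (m + 1) → K) e S = 0 := by
      rw [contract_apply_apply]
      refine Finset.sum_eq_zero fun b _ => ?_
      rw [contractBasis_apply]
      split_ifs with hb
      · simp
      · have : insert b S ≠ Finset.univ := by
          rw [Ne, ← Finset.card_eq_iff_eq_univ, Finset.card_insert_of_notMem hb, Fintype.card_fin]
          omega
        simp [he, this]
    rw [hc]; simp [this]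
  have hcI : ∀ S, contract (X : Fin (m + 1) → MvPolynomial (Fin (m + 1)) K) c S ∈
      projVanishingIdeal (standardPoints K m) := by
    intro S
    rw [mem_projVanishingIdeal_iff (contract_X_isHomogeneous hch S)]
    intro o
    rw [eval_contract_X]
    cases o with
    | none =>
      have : (fun T => eval (standardVector K m none) (c T)) =
          contract (1 : Fin (m + 1) → K) e := by
        ext1 T; simp [hc, hq, standardVector]
      rw [this]
      exact congrFun (contract_contract _ _) S
    | some i =>
      have : (fun T => eval (standardVector K m (some i)) (c T)) = 0 := by
        ext1 T; simp [hc, standardVector, hqs]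
      rw [this, map_zero]; rfl
  choose y hy using fun S => (hmem _).1 (hcI S)
  obtain ⟨w, v, hwv⟩ := h (fun S _ => c S) ⟨y, by
    ext1 S; ext1 i; rw [huniq i, hy, contract_X_apply_coord]⟩
  have hcomp : F.component 0 m (m + 2) (fun S _ => c S) = fun S _ => c S := by
    ext1 S; ext1 i
    simp only [component]
    split_ifs with hS
    · rw [huniq i, hdeg, show (m : ℤ) + 2 - m - 0 = (2 : ℕ) by push_cast; ring,
        intComponent_natCast, homogeneousComponent_eq_self (hch S)]
    · rw [hck S hS]
  obtain ⟨k, rfl⟩ : ∃ k, m = k + 1 := ⟨m - 1, by omega⟩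
  have hwv2 := congrArg (F.component 0 (k + 1) ((k + 1 : ℕ) + 2)) hwv
  rw [hcomp] at hwv2
  rw [hcomp] at hwv2
  have hadd : F.component 0 (k + 1) ((k + 1 : ℕ) + 2)
      (contract (X : Fin (k + 1 + 1) → MvPolynomial (Fin (k + 1 + 1)) K) w +
        fun S => (F.φ 0).mulVec (v S)) =
      F.component 0 (k + 1) ((k + 1 : ℕ) + 2) (contract (X : Fin (k + 1 + 1) → MvPolynomial (Fin (k + 1 + 1)) K) w) +
      F.component 0 (k + 1) ((k + 1 : ℕ) + 2) (fun S => (F.φ 0).mulVec (v S)) := by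
    ext1 S; ext1 i
    simp only [component, Pi.add_apply]
    split_ifs <;> simp
  rw [hadd, component_contract, component_φ] at hwv2
  set w' := F.component 0 (k + 1 + 1) ((k + 1 : ℕ) + 2) w with hw'
  have hw0 : ∀ S, S ≠ Finset.univ → w' S i₀ = 0 := by
    intro S hS
    refine if_neg fun h => hS ?_
    rw [← Finset.card_eq_iff_eq_univ, h, Fintype.card_fin]
  have hw1 : (w' Finset.univ i₀).IsHomogeneous 1 := by
    rw [hw', component, if_pos (by simp), hdeg,
      show ((k + 1 : ℕ) : ℤ) + 2 - (k + 1 + 1 : ℕ) - 0 = (1 : ℕ) by push_cast; ring,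
      intComponent_natCast]
    exact homogeneousComponent_isHomogeneous _ _
  have hdiff : ∀ S, c S - contract (X : Fin (k + 1 + 1) → MvPolynomial (Fin (k + 1 + 1)) K)
      (fun T => w' T i₀) S ∈ projVanishingIdeal (standardPoints K (k + 1)) := by
    intro S
    rw [hmem]
    have := congrFun (congrFun hwv2 S) i₀
    rw [Pi.add_apply, Pi.add_apply, contract_X_apply_coord] at this
    exact ⟨_, (sub_eq_iff_eq_add'.2 this).symm⟩
  have hwh : ∀ S, (w' S i₀).IsHomogeneous 1 := by
    intro S
    by_cases hS : S = Finset.univ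
    · rw [hS]; exact hw1
    · rw [hw0 S hS]; exact isHomogeneous_zero _ _ _
  -- Compare the coefficients at the complement of `b`; the common wedge sign is then cancelled.
  have hev : ∀ (o) (b : Fin (k + 1 + 1)), standardVector K (k + 1) o b *
      eval (standardVector K (k + 1) o) (w' Finset.univ i₀) =
      eval (standardVector K (k + 1) o) q := by
    intro o b
    have h1 := (mem_projVanishingIdeal_iff ((hch (Finset.univ.erase b)).sub
      (contract_X_isHomogeneous hwh _))).1 (hdiff (Finset.univ.erase b)) o
    have hsum : ∀ (x : Fin (k + 1 + 1) → K) (f : Finset (Fin (k + 1 + 1)) → K),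
        contract x f (Finset.univ.erase b) =
          x b * (wedgeSign b (Finset.univ.erase b) • f Finset.univ) := by
      intro x f
      rw [contract_apply_apply, Finset.sum_eq_single b]
      · rw [contractBasis_apply, if_neg (by simp), Finset.insert_erase (Finset.mem_univ b)]; rfl
      · intro a _ ha
        rw [contractBasis_apply, if_pos (by simp [ha]), smul_zero]
      · simp
    rw [map_sub, eval_contract_X, hsum, hc, map_mul, eval_C, hsum] at h1
    simp only [he, if_true, Pi.one_apply, one_mul] at h1
    have h2 := congrArg (wedgeSign b (Finset.univ.erase b) • ·) h1
    simp only [smul_sub, smul_zero, smul_mul_assoc, mul_smul_comm, smul_smul, wedgeSign_mul_self,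
      one_smul, one_mul] at h2
    linear_combination -h2
  have hl : w' Finset.univ i₀ = 0 := by
    rw [hw1.eq_sum_X]
    refine Finset.sum_eq_zero fun i _ => ?_
    have := hev (some i) i
    simp only [standardVector, Pi.single_eq_same, one_mul, hqs] at this
    rw [this, map_zero, zero_mul]
  have := hev none 0
  rw [hl] at this
  simp [standardVector, hq] at this

end Standard

end MinimalFreeResolution

/-! ### Quadrics, their coefficients, and the rigidity of two syzygies. -/

section Quadrics

variable {σ K : Type*} [Field K]

theorem MvPolynomial.IsHomogeneous.eval_add [Fintype σ] [DecidableEq σ] {p : MvPolynomial σ K}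
    (hp : p.IsHomogeneous 1) (u v : σ → K) : eval (u + v) p = eval u p + eval v p := by
  rw [hp.eq_sum_X]
  simp [mul_add, Finset.sum_add_distrib]

theorem MvPolynomial.IsHomogeneous.pderiv_eq_C [Fintype σ] [DecidableEq σ] {p : MvPolynomial σ K}
    (hp : p.IsHomogeneous 1) (a : σ) : pderiv a p = C (eval (Pi.single a 1) p) := by
  conv_lhs => rw [hp.eq_sum_X]
  simp [pderiv_X, Pi.single_apply]

/-- The coefficient of `X a * X b`. -/
noncomputable def quadCoeff (a b : σ) : MvPolynomial σ K →ₗ[K] K :=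
  lcoeff K (Finsupp.single a 1 + Finsupp.single b 1)

theorem quadCoeff_apply (a b : σ) (p : MvPolynomial σ K) :
    quadCoeff a b p = coeff (Finsupp.single a 1 + Finsupp.single b 1) p := rfl

theorem quadCoeff_comm (a b : σ) (p : MvPolynomial σ K) : quadCoeff a b p = quadCoeff b a p := by
  rw [quadCoeff_apply, quadCoeff_apply, add_comm]

theorem exists_eq_single_of_degree_one {s : σ →₀ ℕ} (h : s.degree = 1) :
    ∃ a, s = Finsupp.single a 1 := by
  obtain ⟨a, ha⟩ : ∃ a, s a ≠ 0 := by
    by_contra! h0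
    have : s = 0 := Finsupp.ext h0
    simp [this] at h
  have hle : Finsupp.single a 1 ≤ s := by simpa [Nat.one_le_iff_ne_zero] using ha
  obtain ⟨t, rfl⟩ := exists_add_of_le hle
  rw [map_add, Finsupp.degree_single] at h
  obtain rfl : t = 0 := (Finsupp.degree_eq_zero_iff t).1 (by omega)
  exact ⟨a, by simp⟩

theorem exists_eq_single_add_single_of_degree_two {s : σ →₀ ℕ} (h : s.degree = 2) :
    ∃ a b, s = Finsupp.single a 1 + Finsupp.single b 1 := by
  obtain ⟨a, ha⟩ : ∃ a, s a ≠ 0 := by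
    by_contra! h0
    have : s = 0 := Finsupp.ext h0
    simp [this] at h
  have hle : Finsupp.single a 1 ≤ s := by simpa [Nat.one_le_iff_ne_zero] using ha
  obtain ⟨t, rfl⟩ := exists_add_of_le hle
  rw [map_add, Finsupp.degree_single] at h
  obtain ⟨b, rfl⟩ := exists_eq_single_of_degree_one (s := t) (by omega)
  exact ⟨a, b, rfl⟩

theorem MvPolynomial.IsHomogeneous.eq_zero_of_quadCoeff {p : MvPolynomial σ K}
    (hp : p.IsHomogeneous 2) (h : ∀ a b, quadCoeff a b p = 0) : p = 0 := by
  ext s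
  by_cases hs : s.degree = 2
  · obtain ⟨a, b, rfl⟩ := exists_eq_single_add_single_of_degree_two hs
    exact h a b
  · rw [hp.coeff_eq_zero hs, coeff_zero]

theorem eval_single_eq_quadCoeff [DecidableEq σ] [Fintype σ] {p : MvPolynomial σ K}
    (hp : p.IsHomogeneous 2) (a : σ) : eval (Pi.single a 1) p = quadCoeff a a p := by
  have h2 : ∀ s ∈ p.support, coeff s p * ∏ i, (Pi.single a 1 : σ → K) i ^ s i =
      if s = Finsupp.single a 1 + Finsupp.single a 1 then coeff s p else 0 := by
    intro s hs
    have hs2 : s.degree = 2 := by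
      by_contra h
      exact (mem_support_iff.1 hs) (hp.coeff_eq_zero h)
    obtain ⟨u, v, rfl⟩ := exists_eq_single_add_single_of_degree_two hs2
    simp only [Finsupp.add_apply, pow_add, Finset.prod_mul_distrib, Finsupp.single_apply,
      Finset.prod_pow_boole, Finset.mem_univ, if_true]
    by_cases hu : u = a
    · by_cases hv : v = a
      · simp [hu, hv]
      · have : v ≠ a := hv
        simp [hu, hv, Finsupp.single_left_inj]
    · have h1 : Finsupp.single u 1 + Finsupp.single v 1 ≠
          (Finsupp.single a 1 + Finsupp.single a 1 : σ →₀ ℕ) := by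
        intro h
        have := DFunLike.congr_fun h u
        simp [Finsupp.single_apply, Ne.symm hu] at this
      simp [hu, h1]
  rw [eval_eq', Finset.sum_congr rfl h2, Finset.sum_ite_eq', quadCoeff_apply]
  split_ifs with h
  · rfl
  · exact (notMem_support_iff.1 h).symm

/-- The square of `X a` has to be absent, since its derivative would bring in a factor 2. -/
theorem pderiv_eq_sum_quadCoeff [DecidableEq σ] [Fintype σ] {p : MvPolynomial σ K}
    (hp : p.IsHomogeneous 2) {a : σ} (ha : quadCoeff a a p = 0) :
    pderiv a p = ∑ b, C (quadCoeff a b p) * X b := by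
  ext s
  rw [coeff_pderiv, coeff_sum]
  by_cases hs : s.degree = 1
  · obtain ⟨b, rfl⟩ := exists_eq_single_of_degree_one hs
    simp only [coeff_C_mul, coeff_X, Finsupp.single_left_inj one_ne_zero, mul_ite, mul_one,
      mul_zero, Finset.sum_ite_eq', Finset.mem_univ, if_true]
    rw [quadCoeff_comm, quadCoeff_apply]
    by_cases hab : b = a
    · subst hab
      rw [← quadCoeff_apply, ha, zero_mul]
    · simp [hab]
  · rw [hp.coeff_eq_zero, zero_mul, Finset.sum_eq_zero]
    · intro b _
      rw [coeff_C_mul, coeff_X, if_neg, mul_zero]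
      rintro rfl
      simp at hs
    · rw [map_add, Finsupp.degree_single]
      omega

/-- A quadric whose only monomials are the products of two out of three given variables. -/
theorem MvPolynomial.IsHomogeneous.eq_three_terms {p : MvPolynomial σ K} (hp : p.IsHomogeneous 2)
    {a b c : σ} (hab : a ≠ b) (hbc : b ≠ c) (hca : c ≠ a) (hsq : ∀ u, quadCoeff u u p = 0)
    (h : ∀ u v, u ≠ a → u ≠ b → u ≠ c → quadCoeff u v p = 0) :
    p = C (quadCoeff a b p) * (X a * X b) + C (quadCoeff b c p) * (X b * X c) +
      C (quadCoeff c a p) * (X c * X a) := by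
  classical
  have hm : ∀ (r : K) (u v : σ), C r * (X u * X v : MvPolynomial σ K) =
      monomial (Finsupp.single u 1 + Finsupp.single v 1) r := by
    intro r u v
    rw [X, X, monomial_mul, C_mul_monomial]; simp
  have hne : ∀ {u v w : σ}, u ≠ w → (Finsupp.single u 1 + Finsupp.single v 1 : σ →₀ ℕ) ≠
      Finsupp.single v 1 + Finsupp.single w 1 := by
    intro u v w huw heq
    rw [add_comm, add_right_inj] at heq
    exact huw ((Finsupp.single_left_inj one_ne_zero).1 heq)
  ext s
  rw [hm, hm, hm, coeff_add, coeff_add, coeff_monomial, coeff_monomial, coeff_monomial]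
  by_cases h1 : Finsupp.single a 1 + Finsupp.single b 1 = s
  · rw [if_pos h1, if_neg, if_neg, ← h1, quadCoeff_apply]; · ring
    · rw [← h1]; exact hne hbc.symm
    · rw [← h1]; exact (hne hca.symm).symm
  by_cases h2 : Finsupp.single b 1 + Finsupp.single c 1 = s
  · rw [if_neg h1, if_pos h2, if_neg, ← h2, quadCoeff_apply]; · ring
    · rw [← h2]; exact (hne hab.symm).symm
  by_cases h3 : Finsupp.single c 1 + Finsupp.single a 1 = s
  · rw [if_neg h1, if_neg h2, if_pos h3, ← h3, quadCoeff_apply]; ring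
  rw [if_neg h1, if_neg h2, if_neg h3, add_zero, add_zero]
  by_cases hs : s.degree = 2
  · obtain ⟨u, v, rfl⟩ := exists_eq_single_add_single_of_degree_two hs
    rw [← quadCoeff_apply]
    by_cases hu : u ≠ a ∧ u ≠ b ∧ u ≠ c
    · exact h u v hu.1 hu.2.1 hu.2.2
    by_cases hv : v ≠ a ∧ v ≠ b ∧ v ≠ c
    · rw [quadCoeff_comm]; exact h v u hv.1 hv.2.1 hv.2.2
    have hu' : u = a ∨ u = b ∨ u = c := by tauto
    have hv' : v = a ∨ v = b ∨ v = c := by tauto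
    rcases hu' with rfl | rfl | rfl <;> rcases hv' with rfl | rfl | rfl <;>
      first
      | exact hsq _
      | exact absurd rfl h1
      | exact absurd rfl h2
      | exact absurd rfl h3
      | exact absurd (add_comm _ _) h1
      | exact absurd (add_comm _ _) h2
      | exact absurd (add_comm _ _) h3
  · exact hp.coeff_eq_zero hs

theorem X_sub_X_ne_zero {a b : σ} (h : a ≠ b) : (X a - X b : MvPolynomial σ K) ≠ 0 :=
  sub_ne_zero.2 fun h' => h (X_injective h')

theorem isHomogeneous_of_X_mul {a : σ} {p : MvPolynomial σ K} {n : ℕ}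
    (h : (X a * p).IsHomogeneous (n + 1)) : p.IsHomogeneous n := by
  intro s hs
  have h1 := @h (Finsupp.single a 1 + s) (by rwa [coeff_X_mul])
  have h2 : Finsupp.weight 1 (Finsupp.single a 1 : σ →₀ ℕ) = 1 := by
    simp [Finsupp.weight_apply]
  rw [map_add, h2] at h1
  change Finsupp.weight 1 s = n
  omega

/-- Three quadrics with two syzygies of this shape are determined up to a scalar. -/
theorem exists_scalar_of_syzygies [Fintype σ] {a b c : σ} (hab : a ≠ b) (hbc : b ≠ c) (hca : c ≠ a)
    {P Q R : MvPolynomial σ K} (hP : P.IsHomogeneous 2) (hQ : Q.IsHomogeneous 2)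
    (hsum : P + Q + R = 0) (hsyz : X a * X b * P + X b * X c * Q + X c * X a * R = 0) :
    ∃ μ : K, P = C μ * (X c * (X b - X a)) ∧ Q = C μ * (X a * (X c - X b)) ∧
      R = C μ * (X b * (X a - X c)) := by
  classical
  have hdvd : ∀ {u v : σ}, u ≠ v → ¬ (X u : MvPolynomial σ K) ∣ X v := fun h h' =>
    h (X_dvd_X.1 h')
  have hdvd' : ∀ {u v w : σ}, u ≠ w → v ≠ w → u ≠ v →
      ¬ (X w : MvPolynomial σ K) ∣ X u - X v := by
    rintro u v w huw hvw huv ⟨q, hq⟩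
    have := congrArg (eval (Pi.single u 1)) hq
    simp [huv.symm, huw.symm] at this
  -- Eliminating `R` leaves one relation, from which `X c` divides `P` and `X a` divides `Q`.
  have h1 : X a * (X b - X c) * P = X c * (X a - X b) * Q := by
    linear_combination hsyz - X c * X a * hsum
  obtain ⟨P', rfl⟩ : X c ∣ P := by
    have h2 : X c ∣ X a * ((X b - X c) * P) :=
      ⟨(X a - X b) * Q, by linear_combination h1⟩
    rcases (X_prime.dvd_or_dvd h2) with h | h
    · exact absurd h (hdvd hca)
    rcases (X_prime.dvd_or_dvd h) with h | h
    · exfalso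
      exact hdvd hbc.symm (by simpa using dvd_add h (dvd_refl (X c)))
    · exact h
  obtain ⟨Q', rfl⟩ : X a ∣ Q := by
    have h2 : X a ∣ X c * ((X a - X b) * Q) :=
      ⟨(X b - X c) * (X c * P'), by linear_combination -h1⟩
    rcases (X_prime.dvd_or_dvd h2) with h | h
    · exact absurd h (hdvd hca.symm)
    rcases (X_prime.dvd_or_dvd h) with h | h
    · exfalso
      exact hdvd hab (by simpa using dvd_sub (dvd_refl (X a)) h)
    · exact h
  have h3 : (X b - X c) * P' = (X a - X b) * Q' := by
    refine mul_left_cancel₀ (mul_ne_zero (X_ne_zero a) (X_ne_zero c)) ?_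
    linear_combination h1
  have hP' : P'.IsHomogeneous 1 := isHomogeneous_of_X_mul hP
  -- Putting `X a` equal to `X b` kills the right side of `h3`. So the linear form `P'` vanishes
  -- after this substitution, which makes it a multiple of `X b - X a`.
  set f : σ → MvPolynomial σ K := fun i => if i = a then X b else X i with hf
  have h4 : bind₁ f P' = 0 := by
    have h5 := congrArg (bind₁ f) h3
    simp only [map_mul, map_sub, bind₁_X_right, hf, if_true, if_neg hab.symm, if_neg hca, sub_self,
      zero_mul] at h5
    exact (mul_eq_zero.1 h5).resolve_left (X_sub_X_ne_zero hbc)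
  have h6 : ∀ j, eval (fun i => eval (Pi.single j 1 : σ → K) (f i)) P' = 0 := by
    intro j
    have h7 := congrArg (MvPolynomial.aeval (R := K) (Pi.single j 1 : σ → K)) h4
    rw [aeval_bind₁, map_zero] at h7
    simpa only [aeval_eq_eval] using h7
  have h8 : ∀ j, j ≠ a → j ≠ b → eval (Pi.single j 1) P' = 0 := by
    intro j hja hjb
    rw [← h6 j]
    congr 2
    ext1 i
    simp only [hf]
    by_cases hi : i = a
    · simp [hi, hja.symm, hjb.symm]
    · simp [hi]
  have h9 : eval (Pi.single a 1) P' = -eval (Pi.single b 1) P' := by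
    rw [eq_neg_iff_add_eq_zero, ← hP'.eval_add, ← h6 b]
    congr 2
    ext1 i
    simp only [hf, Pi.add_apply]
    by_cases hi : i = a
    · subst hi; simp [hab]
    · simp [hi]
  have h10 : P' = C (eval (Pi.single b 1) P') * (X b - X a) := by
    conv_lhs => rw [hP'.eq_sum_X, ← Finset.add_sum_erase _ _ (Finset.mem_univ a),
      ← Finset.add_sum_erase _ _ (Finset.mem_erase.2 ⟨hab.symm, Finset.mem_univ b⟩)]
    rw [Finset.sum_eq_zero, h9, C_neg]
    · ring
    · intro j hj
      simp only [Finset.mem_erase] at hj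
      rw [h8 j hj.2.1 hj.1, C_0, zero_mul]
  set μ := eval (Pi.single b 1) P'
  have h11 : Q' = C μ * (X c - X b) := by
    refine mul_left_cancel₀ (X_sub_X_ne_zero (K := K) hab) ?_
    rw [← h3, h10]; ring
  refine ⟨μ, ?_, ?_, ?_⟩
  · rw [h10]; ring
  · rw [h11]; ring
  · rw [h10, h11] at hsum
    linear_combination hsum

end Quadrics

section Syzygies

variable {σ K : Type*} [Field K] [Fintype σ] [DecidableEq σ] {q : σ → MvPolynomial σ K}

/-- The coefficient of `X a ^ 2 * X b` in the relation. -/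
theorem quadCoeff_add_of_syzygy (hq : ∑ c, X c * q c = 0) {a b : σ} (hab : a ≠ b) :
    quadCoeff a b (q a) + quadCoeff a a (q b) = 0 := by
  have h1 := congrArg (coeff (Finsupp.single a 1 + (Finsupp.single a 1 + Finsupp.single b 1))) hq
  rw [coeff_sum, ← Finset.add_sum_erase _ _ (Finset.mem_univ a),
    ← Finset.add_sum_erase _ _ (Finset.mem_erase.2 ⟨hab.symm, Finset.mem_univ b⟩),
    Finset.sum_eq_zero, coeff_X_mul, ← quadCoeff_apply,
    show Finsupp.single a 1 + (Finsupp.single a 1 + Finsupp.single b 1) =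
      (Finsupp.single b 1 + (Finsupp.single a 1 + Finsupp.single a 1) : σ →₀ ℕ) by abel,
    coeff_X_mul, ← quadCoeff_apply, coeff_zero, add_zero] at h1
  · exact h1
  · intro e he
    simp only [Finset.mem_erase] at he
    rw [coeff_X_mul', if_neg]
    simp [he.1, he.2.1]

/-- The coefficient of `X a * X b * X c` in the relation. -/
theorem quadCoeff_add_add_of_syzygy (hq : ∑ c, X c * q c = 0) {a b c : σ} (hab : a ≠ b)
    (hbc : b ≠ c) (hca : c ≠ a) :
    quadCoeff b c (q a) + quadCoeff c a (q b) + quadCoeff a b (q c) = 0 := by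
  have h1 := congrArg (coeff (Finsupp.single a 1 + (Finsupp.single b 1 + Finsupp.single c 1))) hq
  rw [coeff_sum, ← Finset.add_sum_erase _ _ (Finset.mem_univ a),
    ← Finset.add_sum_erase _ _ (Finset.mem_erase.2 ⟨hab.symm, Finset.mem_univ b⟩),
    ← Finset.add_sum_erase _ _ (Finset.mem_erase.2 ⟨hbc.symm,
      Finset.mem_erase.2 ⟨hca, Finset.mem_univ c⟩⟩),
    Finset.sum_eq_zero, coeff_X_mul, ← quadCoeff_apply,
    show Finsupp.single a 1 + (Finsupp.single b 1 + Finsupp.single c 1) =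
      (Finsupp.single b 1 + (Finsupp.single c 1 + Finsupp.single a 1) : σ →₀ ℕ) by abel,
    coeff_X_mul, ← quadCoeff_apply,
    show Finsupp.single b 1 + (Finsupp.single c 1 + Finsupp.single a 1) =
      (Finsupp.single c 1 + (Finsupp.single a 1 + Finsupp.single b 1) : σ →₀ ℕ) by abel,
    coeff_X_mul, ← quadCoeff_apply, coeff_zero, add_zero, ← add_assoc] at h1
  · exact h1
  · intro e he
    simp only [Finset.mem_erase] at he
    rw [coeff_X_mul', if_neg]
    simp [he.1, he.2.1, he.2.2.1]

end Syzygies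

/-! ### Slopes of the linear differentials and their anticommutation. -/

namespace MinimalFreeResolution

section Slopes

variable {σ K : Type*} [Field K] [DecidableEq σ] {I : Ideal (MvPolynomial σ K)}
  (F : MinimalFreeResolution I)

/-- The value of the `k`-th differential at the `a`-th unit vector, that is, the coefficient of
`X a` if the differential is linear. -/
noncomputable def slope (k : ℕ) (a : σ) : Matrix (Fin (F.rank k)) (Fin (F.rank (k + 1))) K :=
  (F.φ k).map (eval (Pi.single a 1))

/-- The product of the slopes of the differentials `1, …, k` in the directions `d 0, d 1, …`. -/
noncomputable def slopeProd : (k : ℕ) → (ℕ → σ) →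
    Matrix (Fin (F.rank (0 + 1))) (Fin (F.rank (k + 1))) K
  | 0, _ => 1
  | k + 1, d => slopeProd k d * F.slope (k + 1) (d k)

theorem slopeProd_succ (k : ℕ) (d : ℕ → σ) :
    F.slopeProd (k + 1) d = F.slopeProd k d * F.slope (k + 1) (d k) := rfl

theorem slopeProd_congr {k : ℕ} {d e : ℕ → σ} (h : ∀ i < k, d i = e i) :
    F.slopeProd k d = F.slopeProd k e := by
  induction k with
  | zero => rfl
  | succ k ih =>
    rw [slopeProd_succ, slopeProd_succ, ih fun i hi => h i (by omega), h k (by omega)]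

/-- The differentials `1, …, n` are matrices of linear forms. -/
def LinearUpTo (n : ℕ) : Prop :=
  ∀ j, j ≠ 0 → j ≤ n → ∀ i l, (F.φ j i l).IsHomogeneous 1

variable {F} {n : ℕ}

theorem LinearUpTo.φ_eq [Fintype σ] (h : F.LinearUpTo n) {j : ℕ} (hj : j ≠ 0) (hjn : j ≤ n) :
    F.φ j = ∑ a, (X a : MvPolynomial σ K) • (F.slope j a).map C := by
  ext1 i l
  rw [(h j hj hjn i l).eq_sum_X, Matrix.sum_apply]
  exact Finset.sum_congr rfl fun a _ => mul_comm _ _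

theorem slope_mul_slope_self {j : ℕ} (a : σ) : F.slope j a * F.slope (j + 1) a = 0 := by
  have := congrArg (fun M => M.map (eval (Pi.single a (1 : K)))) (F.φ_mul_φ j)
  simpa [Matrix.map_mul, slope] using this

/-- Polarization: evaluate the composite of two differentials at the sum of two unit vectors, where
the pure terms vanish. -/
theorem LinearUpTo.slope_mul_slope [Fintype σ] (h : F.LinearUpTo n) {j : ℕ} (hj : j ≠ 0) (hjn : j + 1 ≤ n)
    (a b : σ) : F.slope j a * F.slope (j + 1) b = -(F.slope j b * F.slope (j + 1) a) := by
  have h1 := congrArg (fun M => M.map (eval (Pi.single a (1 : K) + Pi.single b (1 : K))))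
    (F.φ_mul_φ j)
  have h2 : ∀ {i}, i ≠ 0 → i ≤ n → (F.φ i).map (eval (Pi.single a (1 : K) + Pi.single b (1 : K))) =
      F.slope i a + F.slope i b := by
    intro i hi hin
    ext s t
    exact (h i hi hin s t).eval_add _ _
  simp only [Matrix.map_mul, h2 hj (by omega), h2 (Nat.succ_ne_zero j) hjn, Matrix.add_mul, Matrix.mul_add,
    slope_mul_slope_self] at h1
  rw [Matrix.map_zero _ (map_zero _)] at h1
  rw [zero_add, add_zero] at h1
  rw [eq_neg_iff_add_eq_zero]
  exact (add_comm _ _).trans h1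

theorem LinearUpTo.slopeProd_swap [Fintype σ] (h : F.LinearUpTo n) {k : ℕ} (hk : k ≤ n) (d : ℕ → σ) {i : ℕ}
    (hi : i + 1 < k) : F.slopeProd k (d ∘ Equiv.swap i (i + 1)) = -F.slopeProd k d := by
  induction k with
  | zero => omega
  | succ k ih =>
    by_cases hik : i + 1 < k
    · rw [slopeProd_succ, slopeProd_succ, ih (by omega) hik, Matrix.neg_mul, Function.comp_apply,
        Equiv.swap_apply_of_ne_of_ne (by omega) (by omega)]
    · obtain rfl : k = i + 1 := by omega
      rw [slopeProd_succ, slopeProd_succ, slopeProd_succ, slopeProd_succ,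
        F.slopeProd_congr (d := d ∘ Equiv.swap i (i + 1)) (e := d)]
      · simp only [Function.comp_apply, Equiv.swap_apply_left, Equiv.swap_apply_right]
        rw [Matrix.mul_assoc, h.slope_mul_slope (by omega) hk, Matrix.mul_neg, Matrix.mul_assoc]
      · intro l hl
        rw [Function.comp_apply, Equiv.swap_apply_of_ne_of_ne (by omega) (by omega)]

/-- By minimality a constant vector killed by all products of slopes is zero. -/
theorem LinearUpTo.eq_zero_of_slopeProd [Fintype σ] (h : F.LinearUpTo n) {k : ℕ} (hk : k ≤ n)
    {u : Fin (F.rank (k + 1)) → K} (hu : ∀ d, (F.slopeProd k d).mulVec u = 0) : u = 0 := by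
  induction k with
  | zero =>
    -- Without variables there is no sequence of directions to test with, but then minimality makes
    -- the differential zero.
    rcases isEmpty_or_nonempty σ with hσ | ⟨⟨a⟩⟩
    · refine F.eq_zero_of_φ_mulVec_C_eq_zero (k := 0) ?_
      ext1 i
      simp only [Matrix.mulVec, dotProduct]
      refine Finset.sum_eq_zero fun l _ => ?_
      have h1 := F.minimal 0 i l
      rw [Set.range_eq_empty, Ideal.span_empty, Ideal.mem_bot] at h1
      rw [h1, zero_mul]
    · simpa [slopeProd] using hu fun _ => a
  | succ k ih =>
    have h1 : ∀ e, (F.slope (k + 1) e).mulVec u = 0 := by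
      intro e
      refine ih (by omega) fun d => ?_
      -- Changing `d` at `k` prescribes the direction of the last factor and leaves the earlier ones
      -- alone.
      have h2 := hu (Function.update d k e)
      rw [slopeProd_succ, Function.update_self, ← Matrix.mulVec_mulVec] at h2
      rwa [F.slopeProd_congr (e := d)] at h2
      intro i hi
      exact Function.update_of_ne (by omega) _ _
    refine F.eq_zero_of_φ_mulVec_C_eq_zero ?_
    rw [h.φ_eq (Nat.succ_ne_zero k) hk, Matrix.sum_mulVec]
    refine Finset.sum_eq_zero fun a _ => ?_
    rw [Matrix.smul_mulVec]
    have h3 : ((F.slope (k + 1) a).map C).mulVec (fun l => (C (u l) : MvPolynomial σ K)) = 0 := by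
      ext1 i
      have := congrArg (C : K → MvPolynomial σ K) (congrFun (h1 a) i)
      simpa [Matrix.mulVec, dotProduct] using this
    rw [h3, smul_zero]

variable (F) (i₀ : Fin (F.rank 0))

/-- The coefficients of `X a * X b` in the quadrics of the row `i₀` of the first differential,
multiplied by the product of slopes. -/
noncomputable def slopeRow (k : ℕ) (d : ℕ → σ) (a b : σ) : Fin (F.rank (k + 1)) → K :=
  Matrix.vecMul (fun l => quadCoeff a b (F.φ 0 i₀ l)) (F.slopeProd k d)

theorem slopeRow_zero (d : ℕ → σ) (a b : σ) :
    F.slopeRow i₀ 0 d a b = fun l => quadCoeff a b (F.φ 0 i₀ l) := by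
  simp [slopeRow, slopeProd]

theorem slopeRow_succ (k : ℕ) (d : ℕ → σ) (a b : σ) :
    F.slopeRow i₀ (k + 1) d a b =
      Matrix.vecMul (F.slopeRow i₀ k d a b) (F.slope (k + 1) (d k)) := by
  rw [slopeRow, slopeProd_succ, ← Matrix.vecMul_vecMul]; rfl

theorem slopeRow_congr {k : ℕ} {d e : ℕ → σ} (h : ∀ i < k, d i = e i) (a b : σ) :
    F.slopeRow i₀ k d a b = F.slopeRow i₀ k e a b := by
  rw [slopeRow, F.slopeProd_congr h, slopeRow]

theorem slopeRow_comm (k : ℕ) (d : ℕ → σ) (a b : σ) :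
    F.slopeRow i₀ k d a b = F.slopeRow i₀ k d b a := by
  simp only [slopeRow, quadCoeff_comm a b]

variable {F} {i₀}

theorem slopeRow_self (hsq : ∀ a l, quadCoeff a a (F.φ 0 i₀ l) = 0) (k : ℕ) (d : ℕ → σ) (a : σ) :
    F.slopeRow i₀ k d a a = 0 := by
  have : (fun l => quadCoeff a a (F.φ 0 i₀ l)) = 0 := funext fun l => hsq a l
  rw [slopeRow, this, Matrix.zero_vecMul]

theorem LinearUpTo.coeff_φ_zero_mul [Fintype σ] (h : F.LinearUpTo n) (hn : 1 ≤ n) (l) :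
    ∑ c, X c * (∑ t, C (F.slope (0 + 1) c t l) * F.φ 0 i₀ t) = 0 := by
  have h1 := congrFun (congrFun (F.φ_mul_φ 0) i₀) l
  rw [Matrix.mul_apply, Matrix.zero_apply] at h1
  rw [← h1]
  simp_rw [Finset.mul_sum]
  rw [Finset.sum_comm]
  refine Finset.sum_congr rfl fun t _ => ?_
  conv_rhs => rw [(h (0 + 1) one_ne_zero hn t l).eq_sum_X, Finset.mul_sum]
  exact Finset.sum_congr rfl fun c _ => by rw [slope, Matrix.map_apply]; ring

theorem vecMul_slope_eq (d : ℕ → σ) (a b c : σ) (l) :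
    Matrix.vecMul (F.slopeRow i₀ 0 d a b) (F.slope (0 + 1) c) l =
      quadCoeff a b (∑ t, C (F.slope (0 + 1) c t l) * F.φ 0 i₀ t) := by
  rw [slopeRow_zero, map_sum]
  simp only [Matrix.vecMul, dotProduct]
  refine Finset.sum_congr rfl fun t _ => ?_
  rw [quadCoeff_apply, quadCoeff_apply, coeff_C_mul, mul_comm]

theorem LinearUpTo.slopeRow_zero_mul_slope [Fintype σ] (h : F.LinearUpTo n) (hn : 1 ≤ n)
    (hsq : ∀ a l, quadCoeff a a (F.φ 0 i₀ l) = 0) (d : ℕ → σ) (a b : σ) :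
    Matrix.vecMul (F.slopeRow i₀ 0 d a b) (F.slope (0 + 1) a) = 0 := by
  by_cases hab : a = b
  · subst hab
    rw [slopeRow_self hsq, Matrix.zero_vecMul]
  ext1 l
  have h1 := quadCoeff_add_of_syzygy (h.coeff_φ_zero_mul hn (i₀ := i₀) l) hab
  rw [← vecMul_slope_eq (d := d), ← vecMul_slope_eq (d := d), slopeRow_self hsq,
    Matrix.zero_vecMul] at h1
  simpa using h1

theorem LinearUpTo.slopeRow_zero_three [Fintype σ] (h : F.LinearUpTo n) (hn : 1 ≤ n)
    (d : ℕ → σ) {a b c : σ} (hab : a ≠ b) (hbc : b ≠ c) (hca : c ≠ a) :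
    Matrix.vecMul (F.slopeRow i₀ 0 d b c) (F.slope (0 + 1) a) +
      Matrix.vecMul (F.slopeRow i₀ 0 d c a) (F.slope (0 + 1) b) +
      Matrix.vecMul (F.slopeRow i₀ 0 d a b) (F.slope (0 + 1) c) = 0 := by
  ext1 l
  have h1 := quadCoeff_add_add_of_syzygy (h.coeff_φ_zero_mul hn (i₀ := i₀) l) hab hbc hca
  rw [← vecMul_slope_eq (d := d), ← vecMul_slope_eq (d := d), ← vecMul_slope_eq (d := d)] at h1
  exact h1

/-- A repeated direction gives zero: anticommutation moves the new slope to the left until it meets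
its equal, or until it reaches the row of quadrics, where the syzygy without squares annihilates it.
-/
theorem LinearUpTo.slopeRow_mul_slope [Fintype σ] (h : F.LinearUpTo n)
    (hsq : ∀ a l, quadCoeff a a (F.φ 0 i₀ l) = 0) {k : ℕ} (hk : k + 1 ≤ n) (d : ℕ → σ) (a b e : σ)
    (he : e = a ∨ e = b ∨ ∃ i < k, d i = e) :
    Matrix.vecMul (F.slopeRow i₀ k d a b) (F.slope (k + 1) e) = 0 := by
  induction k generalizing e with
  | zero =>
    rcases he with rfl | rfl | ⟨i, hi, _⟩
    · exact h.slopeRow_zero_mul_slope hk hsq d e b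
    · rw [slopeRow_comm]
      exact h.slopeRow_zero_mul_slope hk hsq d e a
    · omega
  | succ k ih =>
    rw [slopeRow_succ, Matrix.vecMul_vecMul]
    by_cases hek : d k = e
    · rw [hek, slope_mul_slope_self, Matrix.vecMul_zero]
    · rw [h.slope_mul_slope (by omega) hk, Matrix.vecMul_neg, ← Matrix.vecMul_vecMul,
        ih (by omega), Matrix.zero_vecMul, neg_zero]
      rcases he with he | he | ⟨i, hi, he⟩
      · exact Or.inl he
      · exact Or.inr (Or.inl he)
      · refine Or.inr (Or.inr ⟨i, ?_, he⟩)
        rcases Nat.lt_succ_iff_lt_or_eq.1 hi with hi | rfl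
        · exact hi
        · exact absurd he hek

/-- The three-term relation of the quadrics is carried through further slopes by anticommuting the
last two factors. -/
theorem LinearUpTo.slopeRow_three [Fintype σ] (h : F.LinearUpTo n) {k : ℕ} (hk : k + 1 ≤ n)
    (d : ℕ → σ) {a b c : σ} (hab : a ≠ b) (hbc : b ≠ c) (hca : c ≠ a) :
    Matrix.vecMul (F.slopeRow i₀ k d b c) (F.slope (k + 1) a) +
      Matrix.vecMul (F.slopeRow i₀ k d c a) (F.slope (k + 1) b) +
      Matrix.vecMul (F.slopeRow i₀ k d a b) (F.slope (k + 1) c) = 0 := by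
  induction k with
  | zero => exact h.slopeRow_zero_three hk d hab hbc hca
  | succ k ih =>
    simp only [slopeRow_succ, Matrix.vecMul_vecMul, h.slope_mul_slope (Nat.succ_ne_zero k) hk (d k),
      Matrix.vecMul_neg]
    simp only [← Matrix.vecMul_vecMul]
    rw [← neg_add, ← neg_add, ← Matrix.add_vecMul, ← Matrix.add_vecMul, ih (by omega),
      Matrix.zero_vecMul, neg_zero]

theorem LinearUpTo.slopeRow_eq_zero [Fintype σ] (h : F.LinearUpTo n)
    (hsq : ∀ a l, quadCoeff a a (F.φ 0 i₀ l) = 0) {k : ℕ} (hk : k ≤ n) (d : ℕ → σ) (a b : σ)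
    (hd : ∃ j < k, d j = a ∨ d j = b ∨ ∃ i < j, d i = d j) :
    F.slopeRow i₀ k d a b = 0 := by
  induction k with
  | zero => obtain ⟨j, hj, _⟩ := hd; omega
  | succ k ih =>
    obtain ⟨j, hj, hd⟩ := hd
    rw [slopeRow_succ]
    rcases Nat.lt_succ_iff_lt_or_eq.1 hj with hj | rfl
    · rw [ih (by omega) ⟨j, hj, hd⟩, Matrix.zero_vecMul]
    · exact h.slopeRow_mul_slope hsq hk d a b _ hd

end Slopes

end MinimalFreeResolution

/-! ### Pairing the linear strand with a column of quadrics. -/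

namespace MinimalFreeResolution

section Directions

variable {σ : Type*} {n : ℕ} {d : ℕ → σ}

theorem injOn_of_bijective (hd : Function.Bijective fun i : Fin (n + 3) => d i) {i j : ℕ}
    (hi : i < n + 3) (hj : j < n + 3) (hij : i ≠ j) : d i ≠ d j := fun h =>
  hij (by simpa using hd.1 (a₁ := ⟨i, hi⟩) (a₂ := ⟨j, hj⟩) h)

theorem exists_lt_of_ne (hd : Function.Bijective fun i : Fin (n + 3) => d i) {u : σ}
    (h0 : u ≠ d n) (h1 : u ≠ d (n + 1)) (h2 : u ≠ d (n + 2)) : ∃ i < n, d i = u := by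
  obtain ⟨⟨i, hi⟩, rfl⟩ := hd.2 u
  refine ⟨i, ?_, rfl⟩
  simp only at h0 h1 h2
  by_contra h
  obtain rfl | rfl | rfl : i = n ∨ i = n + 1 ∨ i = n + 2 := by omega
  · exact h0 rfl
  · exact h1 rfl
  · exact h2 rfl

theorem bijective_comp_swap (hd : Function.Bijective fun i : Fin (n + 3) => d i) {i : ℕ}
    (hi : i + 1 < n + 3) :
    Function.Bijective fun j : Fin (n + 3) => (d ∘ Equiv.swap i (i + 1)) j := by
  have : (fun j : Fin (n + 3) => (d ∘ Equiv.swap i (i + 1)) j) =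
      (fun j : Fin (n + 3) => d j) ∘ Equiv.swap ⟨i, by omega⟩ ⟨i + 1, hi⟩ := by
    ext1 j
    simp only [Function.comp_apply, Equiv.swap_apply_def, Fin.ext_iff]
    split_ifs <;> rfl
  rw [this]
  exact hd.comp (Equiv.bijective _)

end Directions

section Pairing

variable {σ K : Type*} [Field K] [DecidableEq σ] {I : Ideal (MvPolynomial σ K)}
  (F : MinimalFreeResolution I) (i₀ : Fin (F.rank 0))

/-- The first differential is a row of quadrics that vanish at the unit vectors and at the
all-ones vector, and the next `n` differentials are linear. -/
structure LinearStrand (n : ℕ) : Prop where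
  eq_zero : ∀ i, i = i₀
  quadric : ∀ l, (F.φ 0 i₀ l).IsHomogeneous 2
  eval_single : ∀ a l, eval (Pi.single a 1) (F.φ 0 i₀ l) = 0
  eval_one : ∀ l, eval 1 (F.φ 0 i₀ l) = 0
  linear : F.LinearUpTo n

/-- The product of a row of coefficients of the first differential, the slopes of the next `n`
differentials, and a column `y`. -/
noncomputable def pairing (n : ℕ) (d : ℕ → σ) (y : Fin (F.rank (n + 1)) → MvPolynomial σ K)
    (a b : σ) : MvPolynomial σ K :=
  ∑ l, C (F.slopeRow i₀ n d a b l) * y l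

theorem pairing_comm (n : ℕ) (d : ℕ → σ) (y : Fin (F.rank (n + 1)) → MvPolynomial σ K) (a b : σ) :
    F.pairing i₀ n d y a b = F.pairing i₀ n d y b a := by
  simp only [pairing, F.slopeRow_comm i₀ n d a b]

theorem pairing_congr {n : ℕ} {d e : ℕ → σ} (h : ∀ i < n, d i = e i)
    (y : Fin (F.rank (n + 1)) → MvPolynomial σ K) (a b : σ) :
    F.pairing i₀ n d y a b = F.pairing i₀ n e y a b := by
  simp only [pairing, F.slopeRow_congr i₀ h]

variable {F i₀} {n : ℕ} {y : Fin (F.rank (n + 1)) → MvPolynomial σ K} {d : ℕ → σ}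

theorem pairing_isHomogeneous (hy : ∀ l, (y l).IsHomogeneous 2) (a b : σ) :
    (F.pairing i₀ n d y a b).IsHomogeneous 2 :=
  IsHomogeneous.sum _ _ _ fun l _ => (hy l).C_mul _

/-- The first differential, multiplied by a product of slopes. -/
noncomputable def slopeQuadric (F : MinimalFreeResolution I) (i₀ : Fin (F.rank 0)) (n : ℕ)
    (d : ℕ → σ) (l : Fin (F.rank (n + 1))) : MvPolynomial σ K :=
  ∑ t, C (F.slopeProd n d t l) * F.φ 0 i₀ t

theorem quadCoeff_slopeQuadric (u v : σ) (l) :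
    quadCoeff u v (F.slopeQuadric i₀ n d l) = F.slopeRow i₀ n d u v l := by
  rw [slopeQuadric, map_sum]
  simp only [slopeRow, Matrix.vecMul, dotProduct]
  refine Finset.sum_congr rfl fun t _ => ?_
  rw [quadCoeff_apply, quadCoeff_apply, coeff_C_mul, mul_comm]

theorem pairing_succ {k : ℕ} {y : Fin (F.rank (k + 1 + 1)) → MvPolynomial σ K} (u v : σ) :
    F.pairing i₀ (k + 1) d y u v =
      ∑ l, C (Matrix.vecMul (F.slopeRow i₀ k d u v) (F.slope (k + 1) (d k)) l) * y l := by
  simp only [pairing, slopeRow_succ]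

variable [Fintype σ]

theorem LinearStrand.quadCoeff_self (h : F.LinearStrand i₀ n) (a : σ) (l) :
    quadCoeff a a (F.φ 0 i₀ l) = 0 := by
  rw [← eval_single_eq_quadCoeff (h.quadric l), h.eval_single]

/-- Variables already used as slope directions cannot occur, and squares are absent, so three
monomials remain. -/
theorem LinearStrand.slopeQuadric_eq (h : F.LinearStrand i₀ n)
    (hd : Function.Bijective fun i : Fin (n + 3) => d i) (l) :
    F.slopeQuadric i₀ n d l =
      C (F.slopeRow i₀ n d (d (n + 2)) (d (n + 1)) l) * (X (d (n + 2)) * X (d (n + 1))) +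
      C (F.slopeRow i₀ n d (d (n + 1)) (d n) l) * (X (d (n + 1)) * X (d n)) +
      C (F.slopeRow i₀ n d (d n) (d (n + 2)) l) * (X (d n) * X (d (n + 2))) := by
  have hh : (F.slopeQuadric i₀ n d l).IsHomogeneous 2 :=
    IsHomogeneous.sum _ _ _ fun t _ => (h.quadric t).C_mul _
  have := hh.eq_three_terms
    (injOn_of_bijective hd (i := n + 2) (j := n + 1) (by omega) (by omega) (by omega))
    (injOn_of_bijective hd (i := n + 1) (j := n) (by omega) (by omega) (by omega))
    (injOn_of_bijective hd (i := n) (j := n + 2) (by omega) (by omega) (by omega)) ?_ ?_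
  · simpa only [quadCoeff_slopeQuadric] using this
  · intro u
    rw [quadCoeff_slopeQuadric, slopeRow_self h.quadCoeff_self]; rfl
  · intro u v h2 h1 h0
    obtain ⟨i, hi, hdi⟩ := exists_lt_of_ne hd h0 h1 h2
    rw [quadCoeff_slopeQuadric,
      h.linear.slopeRow_eq_zero h.quadCoeff_self le_rfl d u v ⟨i, hi, Or.inl hdi⟩]
    rfl

/-- Evaluation at the all-ones vector: the quadrics vanish there, so their three remaining
coefficients add up to zero. -/
theorem LinearStrand.pairing_add_add (h : F.LinearStrand i₀ n)
    (hd : Function.Bijective fun i : Fin (n + 3) => d i) :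
    F.pairing i₀ n d y (d (n + 2)) (d (n + 1)) + F.pairing i₀ n d y (d (n + 1)) (d n) +
      F.pairing i₀ n d y (d n) (d (n + 2)) = 0 := by
  simp only [pairing]
  rw [← Finset.sum_add_distrib, ← Finset.sum_add_distrib]
  refine Finset.sum_eq_zero fun l _ => ?_
  rw [← add_mul, ← add_mul, ← C_add, ← C_add]
  have h1 := congrArg (eval (1 : σ → K)) (h.slopeQuadric_eq hd l)
  simp only [slopeQuadric, map_sum, map_mul, h.eval_one, map_add, eval_C, eval_X, Pi.one_apply,
    mul_one, mul_zero, Finset.sum_const_zero] at h1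
  rw [← h1, C_0, zero_mul]

/-- The two nonzero terms of the syzygy that the column `y` provides. -/
theorem LinearStrand.X_mul_add_X_mul {k : ℕ} (h : F.LinearStrand i₀ (k + 1))
    {y : Fin (F.rank (k + 1 + 1)) → MvPolynomial σ K} (hy : (F.φ (k + 1)).mulVec y = 0)
    {u v f g : σ} (hfg : f ≠ g) (hw : ∀ w, w ≠ f → w ≠ g → w = u ∨ w = v ∨ ∃ i < k, d i = w) :
    X f * ∑ l, C (Matrix.vecMul (F.slopeRow i₀ k d u v) (F.slope (k + 1) f) l) * y l +
      X g * ∑ l, C (Matrix.vecMul (F.slopeRow i₀ k d u v) (F.slope (k + 1) g) l) * y l = 0 := by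
  obtain ⟨T, hT⟩ : ∃ T : σ → MvPolynomial σ K, ∀ w, T w =
      ∑ l, C (Matrix.vecMul (F.slopeRow i₀ k d u v) (F.slope (k + 1) w) l) * y l :=
    ⟨_, fun _ => rfl⟩
  have hT' : ∀ w, T w =
      ∑ t, C (F.slopeRow i₀ k d u v t) * ((F.slope (k + 1) w).map C).mulVec y t := by
    intro w
    simp only [hT, Matrix.mulVec, Matrix.vecMul, dotProduct, map_sum, Finset.mul_sum,
      Finset.sum_mul, Matrix.map_apply, map_mul]
    rw [Finset.sum_comm]
    exact Finset.sum_congr rfl fun t _ => Finset.sum_congr rfl fun l _ => by ring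
  -- This is the cycle condition on `y`, multiplied by the constant row. Directions already used
  -- contribute zero, which leaves `f` and `g`.
  have h1 : ∑ w, X w * T w = 0 := by
    have h2 : ∑ t, C (F.slopeRow i₀ k d u v t) * (F.φ (k + 1)).mulVec y t = 0 := by simp [hy]
    rw [h.linear.φ_eq (Nat.succ_ne_zero k) le_rfl] at h2
    rw [← h2]
    simp only [hT', Matrix.sum_mulVec, Finset.sum_apply, Matrix.smul_mulVec, Pi.smul_apply,
      smul_eq_mul, Finset.mul_sum]
    rw [Finset.sum_comm]
    exact Finset.sum_congr rfl fun t _ => Finset.sum_congr rfl fun w _ => by ring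
  rw [← hT, ← hT]
  rw [← Finset.add_sum_erase _ _ (Finset.mem_univ f),
    ← Finset.add_sum_erase _ _ (Finset.mem_erase.2 ⟨hfg.symm, Finset.mem_univ g⟩),
    Finset.sum_eq_zero, add_zero] at h1
  · exact h1
  · intro w hw'
    simp only [Finset.mem_erase] at hw'
    have : Matrix.vecMul (F.slopeRow i₀ k d u v) (F.slope (k + 1) w) = 0 :=
      h.linear.slopeRow_mul_slope h.quadCoeff_self le_rfl d u v w (hw w hw'.2.1 hw'.1)
    simp [hT, this]

/-- With no linear differential this is the cycle condition on `y`, the quadrics being written out.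
Otherwise one slope is freed: each pair among the last three directions gives a two-term relation
between `d k` and the third direction. The unwanted terms cancel by `slopeRow_three`, and `X (d k)`
is divided out. -/
theorem LinearStrand.pairing_syzygy (h : F.LinearStrand i₀ n)
    (hd : Function.Bijective fun i : Fin (n + 3) => d i) (hy : (F.φ n).mulVec y = 0) :
    X (d (n + 2)) * X (d (n + 1)) * F.pairing i₀ n d y (d (n + 2)) (d (n + 1)) +
      X (d (n + 1)) * X (d n) * F.pairing i₀ n d y (d (n + 1)) (d n) +
      X (d n) * X (d (n + 2)) * F.pairing i₀ n d y (d n) (d (n + 2)) = 0 := by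
  cases n with
  | zero =>
    have h1 := congrFun hy i₀
    have h2 : ∀ l, F.φ 0 i₀ l = F.slopeQuadric i₀ 0 d l := by
      intro l
      rw [slopeQuadric, Finset.sum_eq_single l]
      · simp [slopeProd]
      · intro t _ ht
        simp [slopeProd, ht]
      · simp
    simp only [Matrix.mulVec, dotProduct, h2, h.slopeQuadric_eq hd] at h1
    simp only [pairing, Finset.mul_sum]
    rw [← Finset.sum_add_distrib, ← Finset.sum_add_distrib]
    refine Eq.trans ?_ h1
    exact Finset.sum_congr rfl fun l _ => by ring
  | succ k =>
    have hne : ∀ {i j : ℕ}, i < k + 1 + 3 → j < k + 1 + 3 → i ≠ j → d i ≠ d j :=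
      injOn_of_bijective hd
    have hk : ∀ w, w ≠ d k → w ≠ d (k + 1) → w ≠ d (k + 2) → w ≠ d (k + 3) →
        ∃ i < k, d i = w := by
      intro w h0 h1 h2 h3
      obtain ⟨i, hi, rfl⟩ := exists_lt_of_ne hd h1 h2 h3
      refine ⟨i, ?_, rfl⟩
      rcases Nat.lt_succ_iff_lt_or_eq.1 hi with hi | rfl
      · exact hi
      · exact absurd rfl h0
    have e1 := h.X_mul_add_X_mul hy (d := d) (u := d (k + 3)) (v := d (k + 2)) (f := d k)
      (g := d (k + 1)) (hne (by omega) (by omega) (by omega)) (fun w _ _ => by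
        have := hk w; tauto)
    have e2 := h.X_mul_add_X_mul hy (d := d) (u := d (k + 2)) (v := d (k + 1)) (f := d k)
      (g := d (k + 3)) (hne (by omega) (by omega) (by omega)) (fun w _ _ => by
        have := hk w; tauto)
    have e3 := h.X_mul_add_X_mul hy (d := d) (u := d (k + 1)) (v := d (k + 3)) (f := d k)
      (g := d (k + 2)) (hne (by omega) (by omega) (by omega)) (fun w _ _ => by
        have := hk w; tauto)
    have e4 := h.linear.slopeRow_three (i₀ := i₀) le_rfl d (a := d (k + 3)) (b := d (k + 2))
      (c := d (k + 1)) (hne (by omega) (by omega) (by omega)) (hne (by omega) (by omega) (by omega))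
      (hne (by omega) (by omega) (by omega))
    have e5 : ∑ l, C (Matrix.vecMul (F.slopeRow i₀ k d (d (k + 2)) (d (k + 1)))
          (F.slope (k + 1) (d (k + 3))) l) * y l +
        ∑ l, C (Matrix.vecMul (F.slopeRow i₀ k d (d (k + 1)) (d (k + 3)))
          (F.slope (k + 1) (d (k + 2))) l) * y l +
        ∑ l, C (Matrix.vecMul (F.slopeRow i₀ k d (d (k + 3)) (d (k + 2)))
          (F.slope (k + 1) (d (k + 1))) l) * y l = 0 := by
      rw [← Finset.sum_add_distrib, ← Finset.sum_add_distrib]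
      refine Finset.sum_eq_zero fun l _ => ?_
      rw [← add_mul, ← add_mul, ← C_add, ← C_add]
      have := congrFun e4 l
      simp only [Pi.add_apply, Pi.zero_apply] at this
      rw [this, C_0, zero_mul]
    simp only [pairing_succ]
    refine (mul_eq_zero.1 (?_ : X (d k) * _ = 0)).resolve_left (X_ne_zero _)
    linear_combination X (d (k + 3)) * X (d (k + 2)) * e1 + X (d (k + 2)) * X (d (k + 1)) * e2 +
      X (d (k + 1)) * X (d (k + 3)) * e3 - X (d (k + 3)) * X (d (k + 2)) * X (d (k + 1)) * e5

variable (F i₀ y d) in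
/-- The pairings of the last three directions are the standard ones, scaled by `μ`. -/
def HasScalar (μ : K) : Prop :=
  F.pairing i₀ n d y (d (n + 2)) (d (n + 1)) =
      C μ * (X (d n) * (X (d (n + 1)) - X (d (n + 2)))) ∧
    F.pairing i₀ n d y (d (n + 1)) (d n) =
      C μ * (X (d (n + 2)) * (X (d n) - X (d (n + 1)))) ∧
    F.pairing i₀ n d y (d n) (d (n + 2)) =
      C μ * (X (d (n + 1)) * (X (d (n + 2)) - X (d n)))

theorem LinearStrand.exists_hasScalar (h : F.LinearStrand i₀ n)
    (hd : Function.Bijective fun i : Fin (n + 3) => d i) (hy : (F.φ n).mulVec y = 0)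
    (hyh : ∀ l, (y l).IsHomogeneous 2) : ∃ μ, F.HasScalar i₀ y d μ :=
  exists_scalar_of_syzygies
    (injOn_of_bijective hd (i := n + 2) (j := n + 1) (by omega) (by omega) (by omega))
    (injOn_of_bijective hd (i := n + 1) (j := n) (by omega) (by omega) (by omega))
    (injOn_of_bijective hd (i := n) (j := n + 2) (by omega) (by omega) (by omega))
    (pairing_isHomogeneous hyh _ _) (pairing_isHomogeneous hyh _ _) (h.pairing_add_add hd)
    (h.pairing_syzygy hd hy)

/-- Three kinds of transposition: of two slopes, of the last slope with the first free direction,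
and of two free directions. -/
theorem LinearStrand.hasScalar_swap (h : F.LinearStrand i₀ n)
    (hd : Function.Bijective fun i : Fin (n + 3) => d i) (hy : (F.φ n).mulVec y = 0)
    (hyh : ∀ l, (y l).IsHomogeneous 2) {μ : K} (hμ : F.HasScalar i₀ y d μ) {i : ℕ}
    (hi : i + 1 < n + 3) : F.HasScalar i₀ y (d ∘ Equiv.swap i (i + 1)) (-μ) := by
  rcases lt_trichotomy (i + 1) n with hin | hin | hin
  · have hp : ∀ a b, F.pairing i₀ n (d ∘ Equiv.swap i (i + 1)) y a b = -F.pairing i₀ n d y a b := by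
      intro a b
      simp only [pairing, slopeRow, h.linear.slopeProd_swap le_rfl d hin, Matrix.vecMul_neg,
        Pi.neg_apply, C_neg, neg_mul, Finset.sum_neg_distrib]
    have hs : ∀ j, n ≤ j → (d ∘ Equiv.swap i (i + 1)) j = d j := by
      intro j hj
      rw [Function.comp_apply, Equiv.swap_apply_of_ne_of_ne (by omega) (by omega)]
    unfold HasScalar
    rw [hs n le_rfl, hs (n + 1) (by omega), hs (n + 2) (by omega), hp, hp, hp, hμ.1, hμ.2.1,
      hμ.2.2, C_neg]
    refine ⟨?_, ?_, ?_⟩ <;> ring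
  -- The swapped sequence has some scalar `μ'`. The two-term relation, with the last slope removed,
  -- links one pairing of each sequence and yields `μ + μ' = 0`.
  · obtain ⟨μ', hμ'⟩ := h.exists_hasScalar (bijective_comp_swap hd hi) hy hyh
    suffices μ' = -μ by rwa [this] at hμ'
    subst hin
    have hne : ∀ {j l : ℕ}, j < i + 1 + 3 → l < i + 1 + 3 → j ≠ l → d j ≠ d l :=
      injOn_of_bijective hd
    have e1 := h.X_mul_add_X_mul hy (d := d) (u := d (i + 3)) (v := d (i + 2)) (f := d i)
      (g := d (i + 1)) (hne (by omega) (by omega) (by omega)) (fun w h0 h1 => by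
        by_cases h3 : w = d (i + 3)
        · exact Or.inl h3
        by_cases h2 : w = d (i + 2)
        · exact Or.inr (Or.inl h2)
        obtain ⟨j, hj, rfl⟩ := exists_lt_of_ne hd h1 h2 h3
        refine Or.inr (Or.inr ⟨j, ?_, rfl⟩)
        rcases Nat.lt_succ_iff_lt_or_eq.1 hj with hj | rfl
        · exact hj
        · exact absurd rfl h0)
    have e2 := hμ.1
    have e3 := hμ'.1
    have hs : ∀ j, (j < i ∨ i + 1 < j) → (d ∘ Equiv.swap i (i + 1)) j = d j := by
      intro j hj
      rw [Function.comp_apply, Equiv.swap_apply_of_ne_of_ne (by omega) (by omega)]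
    rw [pairing_succ] at e2 e3
    rw [hs (i + 1 + 2) (by omega), hs (i + 1 + 1) (by omega),
      F.slopeRow_congr (e := d) i₀ fun j hj => hs j (Or.inl hj), Function.comp_apply,
      Function.comp_apply, Equiv.swap_apply_left, Equiv.swap_apply_right] at e3
    rw [e2, e3] at e1
    have e4 : X (d i) * (X (d (i + 1)) * ((X (d (i + 1 + 1)) - X (d (i + 1 + 2))) *
        C (μ + μ'))) = 0 := by
      rw [C_add]; linear_combination e1
    have e5 := (mul_eq_zero.1 ((mul_eq_zero.1 ((mul_eq_zero.1 e4).resolve_left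
      (X_ne_zero _))).resolve_left (X_ne_zero _))).resolve_left
      (X_sub_X_ne_zero (hne (by omega) (by omega) (by omega)))
    rw [C_eq_zero] at e5
    linear_combination e5
  -- The pairings do not change here; the standard expressions are antisymmetric in the free
  -- directions.
  · have hp : ∀ a b, F.pairing i₀ n (d ∘ Equiv.swap i (i + 1)) y a b = F.pairing i₀ n d y a b := by
      refine fun a b => F.pairing_congr i₀ (fun j hj => ?_) y a b
      rw [Function.comp_apply, Equiv.swap_apply_of_ne_of_ne (by omega) (by omega)]
    obtain ⟨h1, h2, h3⟩ := hμ
    obtain rfl | rfl : i = n ∨ i = n + 1 := by omega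
    · unfold HasScalar
      simp only [hp, Function.comp_apply, Equiv.swap_apply_left, Equiv.swap_apply_right,
        Equiv.swap_apply_of_ne_of_ne (show i + 2 ≠ i by omega) (show i + 2 ≠ i + 1 by omega), C_neg]
      rw [pairing_comm, h3, pairing_comm, h2, pairing_comm, h1]
      refine ⟨?_, ?_, ?_⟩ <;> ring
    · unfold HasScalar
      simp only [hp, Function.comp_apply, Equiv.swap_apply_left,
        show Equiv.swap (n + 1) (n + 1 + 1) (n + 2) = n + 1 from Equiv.swap_apply_right _ _,
        Equiv.swap_apply_of_ne_of_ne (show n ≠ n + 1 by omega) (show n ≠ n + 1 + 1 by omega), C_neg]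
      rw [show n + 1 + 1 = n + 2 from rfl, pairing_comm, h1, pairing_comm, h3, pairing_comm, h2]
      refine ⟨?_, ?_, ?_⟩ <;> ring

/-- If all pairings with `y` vanish, then so does `y`. -/
theorem LinearStrand.eq_zero_of_hasScalar_zero (h : F.LinearStrand i₀ n)
    (hσ : Fintype.card σ = n + 3)
    (hy : ∀ d : ℕ → σ, (Function.Bijective fun i : Fin (n + 3) => d i) → F.HasScalar i₀ y d 0) :
    y = 0 := by
  have h1 : ∀ (d : ℕ → σ) (u v : σ), F.pairing i₀ n d y u v = 0 := by
    intro d u v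
    have hz : ∀ u v, F.slopeRow i₀ n d u v = 0 → F.pairing i₀ n d y u v = 0 := by
      intro u v h0
      simp [pairing, h0]
    by_cases huv : u = v
    · subst huv
      exact hz _ _ (slopeRow_self h.quadCoeff_self _ _ _)
    by_cases hd : ∃ j < n, d j = u ∨ d j = v ∨ ∃ i < j, d i = d j
    · exact hz _ _ (h.linear.slopeRow_eq_zero h.quadCoeff_self le_rfl d u v hd)
    push Not at hd
    -- Distinct directions number `n + 2`, so one more completes them to an enumeration of all
    -- variables.
    obtain ⟨w, hw⟩ : ∃ w, w ∉ insert u (insert v ((Finset.range n).image d)) := by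
      by_contra! hcon
      have h2 := Finset.card_le_card (fun x (_ : x ∈ Finset.univ) => hcon x)
      have h3 := Finset.card_insert_le u (insert v ((Finset.range n).image d))
      have h4 := Finset.card_insert_le v ((Finset.range n).image d)
      have h5 := Finset.card_image_le (s := Finset.range n) (f := d)
      rw [Finset.card_univ, hσ] at h2
      rw [Finset.card_range] at h5
      omega
    simp only [Finset.mem_insert, Finset.mem_image, Finset.mem_range, not_or, not_exists,
      not_and] at hw
    obtain ⟨hwu, hwv, hwd⟩ := hw
    set e : ℕ → σ := fun i => if i < n then d i else if i = n then w else if i = n + 1 then v else u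
      with he
    have he1 : ∀ i < n, d i = e i := fun i hi => by simp [he, hi]
    have he2 : e (n + 1) = v := by simp [he]
    have he3 : e (n + 2) = u := by simp [he]
    have hinj : ∀ i j : ℕ, i < j → j < n + 3 → e i ≠ e j := by
      intro i j hij hj
      simp only [he]
      split_ifs with h1 h2 h3 h4 h5 h6 h7 h8 h9 h10 <;> first | omega | skip
      · exact (hd j h2).2.2 i hij
      · exact hwd i h1
      · exact (hd i h1).2.1
      · exact (hd i h1).1
      all_goals first | exact hwv | exact hwu | exact Ne.symm huv
    have hbij : Function.Bijective fun i : Fin (n + 3) => e i := by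
      rw [Fintype.bijective_iff_injective_and_card]
      refine ⟨fun i j hij => ?_, by rw [hσ, Fintype.card_fin]⟩
      by_contra hne
      rcases lt_or_gt_of_ne (fun h => hne (Fin.ext h)) with hlt | hlt
      · exact hinj i j hlt j.2 hij
      · exact hinj j i hlt i.2 hij.symm
    rw [F.pairing_congr i₀ he1, ← he2, ← he3, (hy e hbij).1, C_0, zero_mul]
  -- The coefficients of `y` at a fixed monomial form a constant vector. Its product with slopes is
  -- killed by the first differential, hence zero, and then the vector itself is zero; both
  -- conclusions rest on minimality.
  have h2 : ∀ s : σ →₀ ℕ, (fun l => coeff s (y l)) = 0 := by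
    intro s
    refine h.linear.eq_zero_of_slopeProd le_rfl fun d => ?_
    refine F.eq_zero_of_φ_mulVec_C_eq_zero ?_
    ext1 i
    rw [h.eq_zero i, Pi.zero_apply]
    set x := (F.slopeProd n d).mulVec fun l => coeff s (y l) with hx
    have hh : ((F.φ 0).mulVec (fun l => C (x l)) i₀).IsHomogeneous 2 := by
      simp only [Matrix.mulVec, dotProduct]
      refine IsHomogeneous.sum _ _ _ fun t _ => ?_
      rw [mul_comm]
      exact (h.quadric t).C_mul _
    refine hh.eq_zero_of_quadCoeff fun u v => ?_
    have h3 : quadCoeff u v ((F.φ 0).mulVec (fun l => C (x l)) i₀) =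
        (fun l => quadCoeff u v (F.φ 0 i₀ l)) ⬝ᵥ x := by
      simp only [Matrix.mulVec, dotProduct, map_sum]
      refine Finset.sum_congr rfl fun t _ => ?_
      rw [quadCoeff_apply, quadCoeff_apply, mul_comm, coeff_C_mul, mul_comm]
    rw [h3, hx, Matrix.dotProduct_mulVec]
    have h4 := congrArg (coeff s) (h1 d u v)
    simp only [pairing, coeff_sum, coeff_C_mul, coeff_zero] at h4
    exact h4
  ext l s
  exact congrFun (h2 s) l

end Pairing

end MinimalFreeResolution

/-- An injective functional lives on a space of dimension at most one. It is applied to the scalars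
of the columns of the last differential. -/
theorem le_one_and_ne_zero_of_linear_form {K : Type*} [Field K] {r : ℕ} (f : Fin r → K)
    (h : ∀ w : Fin r → K, ∑ q, w q * f q = 0 → w = 0) : r ≤ 1 ∧ ∀ q, f q ≠ 0 := by
  have h1 : ∀ q, f q ≠ 0 := by
    intro q hq
    have := congrFun (h (Pi.single q 1) (by simp [Pi.single_apply, hq])) q
    simp at this
  refine ⟨?_, h1⟩
  by_contra! hr
  obtain ⟨a, b, hne⟩ : ∃ a b : Fin r, a ≠ b := ⟨⟨0, by omega⟩, ⟨1, hr⟩, by simp⟩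
  have := congrFun (h (Pi.single a (f b) - Pi.single b (f a)) (by
    simp [sub_mul, Finset.sum_sub_distrib, Pi.single_apply, mul_comm (f a)])) a
  simp [hne] at this
  exact h1 _ this

/-! ### The scalar as a function of the permutation. -/

namespace MinimalFreeResolution

section Permutations

variable {K : Type*} [Field K] {n : ℕ} {I : Ideal (MvPolynomial (Fin (n + 3)) K)}
  {F : MinimalFreeResolution I} {i₀ : Fin (F.rank 0)}
  {y : Fin (F.rank (n + 1)) → MvPolynomial (Fin (n + 3)) K}

theorem HasScalar.congr {σ : Type*} [DecidableEq σ] {I : Ideal (MvPolynomial σ K)}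
    {F : MinimalFreeResolution I} {i₀ : Fin (F.rank 0)}
    {y : Fin (F.rank (n + 1)) → MvPolynomial σ K} {d e : ℕ → σ} {μ : K}
    (h : F.HasScalar i₀ y d μ) (hde : ∀ i < n + 3, d i = e i) : F.HasScalar i₀ y e μ := by
  unfold HasScalar at h ⊢
  simpa only [F.pairing_congr i₀ (fun i (hi : i < n) => hde i (by omega)), hde n (by omega),
    hde (n + 1) (by omega), hde (n + 2) (by omega)] using h

theorem bijective_ofNat (ν : Equiv.Perm (Fin (n + 3))) :
    Function.Bijective fun i : Fin (n + 3) => ν (Fin.ofNat (n + 3) i) := by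
  have : (fun i : Fin (n + 3) => ν (Fin.ofNat (n + 3) i)) = ν := by
    ext1 i
    rw [Fin.ofNat_val_eq_self]
  rw [this]
  exact ν.bijective

/-- Adjacent transpositions generate the symmetric group, and each changes the sign. -/
theorem LinearStrand.exists_hasScalar_perm (h : F.LinearStrand i₀ n) (hy : (F.φ n).mulVec y = 0)
    (hyh : ∀ l, (y l).IsHomogeneous 2) : ∃ μ : K, ∀ ν : Equiv.Perm (Fin (n + 3)),
      F.HasScalar i₀ y (fun i => ν (Fin.ofNat (n + 3) i)) (((Equiv.Perm.sign ν : ℤ) : K) * μ) := by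
  obtain ⟨μ, hμ⟩ := h.exists_hasScalar
    (d := fun i => (1 : Equiv.Perm (Fin (n + 3))) (Fin.ofNat (n + 3) i)) (bijective_ofNat 1) hy hyh
  refine ⟨μ, fun ν => ?_⟩
  have hν : ν ∈ Submonoid.closure
      (Set.range fun i : Fin (n + 2) => Equiv.swap i.castSucc i.succ) := by
    rw [Equiv.Perm.mclosure_swap_castSucc_succ]; trivial
  induction hν using Submonoid.closure_induction_right with
  | one => simpa using hμ
  | mul_right ν _ s hs ih =>
    obtain ⟨i, rfl⟩ := hs
    have h1 := h.hasScalar_swap (bijective_ofNat ν) hy hyh ih (i := i) (by omega)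
    have h2 : -(((Equiv.Perm.sign ν : ℤ) : K) * μ) =
        ((Equiv.Perm.sign (ν * Equiv.swap i.castSucc i.succ) : ℤ) : K) * μ := by
      rw [map_mul, Equiv.Perm.sign_swap (by simp [Fin.ext_iff])]
      simp
    rw [h2] at h1
    refine h1.congr fun j hj => ?_
    simp only [Function.comp_apply, Equiv.Perm.mul_apply]
    congr 1
    have hofNat : ∀ l < n + 3, ((Fin.ofNat (n + 3) l : Fin (n + 3)) : ℕ) = l := fun l hl => by
      simp [Nat.mod_eq_of_lt hl]
    simp only [Equiv.swap_apply_def, Fin.ext_iff, hofNat j hj, Fin.val_castSucc, Fin.val_succ]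
    split_ifs
    · rw [hofNat _ (by omega), Fin.val_succ]
    · rw [hofNat _ (by omega), Fin.val_castSucc]
    · rfl

theorem LinearStrand.eq_zero_of_perm (h : F.LinearStrand i₀ n)
    (hy : ∀ ν : Equiv.Perm (Fin (n + 3)),
      F.HasScalar i₀ y (fun i => ν (Fin.ofNat (n + 3) i)) 0) : y = 0 := by
  refine h.eq_zero_of_hasScalar_zero (Fintype.card_fin _) fun d hd => ?_
  refine (hy (Equiv.ofBijective _ hd)).congr fun i hi => ?_
  simp [Nat.mod_eq_of_lt hi]

end Permutations

/-! ### Evaluation of the bracket. -/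

section Bracket

variable {σ K : Type*} [Field K] [Fintype σ] [DecidableEq σ] {I : Ideal (MvPolynomial σ K)}
  {F : MinimalFreeResolution I} {i₀ : Fin (F.rank 0)} {n : ℕ}

/-- The first derivative turns the square-free quadrics into linear forms; every later one picks out
a slope. -/
theorem LinearStrand.bracket_eq (h : F.LinearStrand i₀ n) {k : ℕ} (hk : k ≤ n) (a : ℕ → σ) (l) :
    F.bracket (k + 1) (fun i => a i) i₀ l =
      ∑ c, X c * C (F.slopeRow i₀ k (fun i => a (i + 1)) (a 0) c l) := by
  induction k with
  | zero =>
    have h1 : F.bracket (0 + 1) (fun i => a i) i₀ l = pderiv (a 0) (F.φ 0 i₀ l) := by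
      simp only [bracket]
      rw [Matrix.one_mul]
      rfl
    rw [h1, pderiv_eq_sum_quadCoeff (h.quadric l) (h.quadCoeff_self _ l)]
    refine Finset.sum_congr rfl fun c _ => ?_
    rw [slopeRow_zero, mul_comm]
  | succ k ih =>
    have h1 : F.bracket (k + 1 + 1) (fun i => a i) i₀ l = ∑ t, F.bracket (k + 1) (fun i => a i) i₀ t *
        pderiv (a (k + 1)) (F.φ (k + 1) t l) := rfl
    rw [h1]
    simp only [ih (by omega), (h.linear (k + 1) (Nat.succ_ne_zero k) hk _ _).pderiv_eq_C,
      Finset.sum_mul, slopeRow_succ, Matrix.vecMul, dotProduct, map_sum, Finset.mul_sum, map_mul]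
    rw [Finset.sum_comm]
    refine Finset.sum_congr rfl fun c _ => Finset.sum_congr rfl fun t _ => ?_
    rw [slope, Matrix.map_apply, mul_assoc]

theorem LinearStrand.bracket_last (h : F.LinearStrand i₀ n) (a : ℕ → σ) (q) :
    F.bracket (n + 2) (fun i => a i) i₀ q =
      ∑ c, X c * pderiv (a (n + 1)) (F.pairing i₀ n (fun i => a (i + 1))
        (fun l => F.φ (n + 1) l q) (a 0) c) := by
  have h1 : F.bracket (n + 2) (fun i => a i) i₀ q = ∑ t, F.bracket (n + 1) (fun i => a i) i₀ t *
      pderiv (a (n + 1)) (F.φ (n + 1) t q) := rfl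
  rw [h1]
  simp only [h.bracket_eq le_rfl, pairing, map_sum, pderiv_C_mul, Finset.sum_mul, Finset.mul_sum]
  rw [Finset.sum_comm]
  exact Finset.sum_congr rfl fun c _ => Finset.sum_congr rfl fun t _ => by
    rw [mul_assoc]

/-- Shifting by one puts `a 1, …, a n` into the slope positions and `a (n + 1)`, `a (n + 2)`, `a 0`
into the free ones. In the sum over `c` only `c = a (n + 1)` and `c = a (n + 2)` survive, the latter
being the variable missing from the bracket. -/
theorem LinearStrand.bracket_of_hasScalar (h : F.LinearStrand i₀ n) {a : ℕ → σ} {q} {μ : K}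
    (ha : a (n + 3) = a 0) (hd : Function.Bijective fun i : Fin (n + 3) => a (i + 1))
    (hμ : F.HasScalar i₀ (fun l => F.φ (n + 1) l q) (fun i => a (i + 1)) μ) :
    F.bracket (n + 2) (fun i => a i) i₀ q =
      C μ * ((X (a (n + 2)) - X (a 0) - X (a (n + 1))) * X (a (n + 2))) := by
  set d : ℕ → σ := fun i => a (i + 1) with hd'
  have h02 : d n ≠ d (n + 2) := injOn_of_bijective (d := d) hd (by omega) (by omega) (by omega)
  have h12 : d (n + 1) ≠ d (n + 2) :=
    injOn_of_bijective (d := d) hd (by omega) (by omega) (by omega)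
  have h01 : d n ≠ d (n + 1) := injOn_of_bijective (d := d) hd (by omega) (by omega) (by omega)
  rw [h.bracket_last, ← ha]
  change ∑ c, X c * pderiv (d n) (F.pairing i₀ n d _ (d (n + 2)) c) =
    C μ * ((X (d (n + 1)) - X (d (n + 2)) - X (d n)) * X (d (n + 1)))
  rw [← Finset.add_sum_erase _ _ (Finset.mem_univ (d n)),
    ← Finset.add_sum_erase _ _ (Finset.mem_erase.2 ⟨h01.symm, Finset.mem_univ (d (n + 1))⟩),
    Finset.sum_eq_zero, hμ.1, pairing_comm, hμ.2.2]
  · simp only [pderiv_mul, pderiv_C, map_sub, pderiv_X_self, pderiv_X_of_ne h01.symm,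
      pderiv_X_of_ne h02.symm]
    ring
  · intro c hc
    simp only [Finset.mem_erase] at hc
    have : F.slopeRow i₀ n d (d (n + 2)) c = 0 := by
      by_cases hc2 : c = d (n + 2)
      · rw [hc2]; exact slopeRow_self h.quadCoeff_self _ _ _
      · obtain ⟨i, hi, hdi⟩ := exists_lt_of_ne (d := d) hd hc.2.1 hc.1 hc2
        exact h.linear.slopeRow_eq_zero h.quadCoeff_self le_rfl d _ _ ⟨i, hi, Or.inr (Or.inl hdi)⟩
    simp [pairing, this]

end Bracket

/-! ### The cyclic sums `Omega`. -/

section Rotation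

theorem sum_finRotate_pow {m : ℕ} {A : Type*} [AddCommMonoid A] (g : Fin m → A) (i : Fin m) :
    ∑ t ∈ Finset.range m, g ((finRotate m ^ t) i) = ∑ j, g j := by
  cases m with
  | zero => exact i.elim0
  | succ k =>
    have hpow : ∀ t : Fin (k + 1), (finRotate (k + 1) ^ (t : ℕ)) i = i + t := by
      rintro ⟨t, ht⟩
      have : ∀ t : ℕ, (((finRotate (k + 1) ^ t) i : Fin (k + 1)) : ℕ) = (i + t) % (k + 1) := by
        intro t
        induction t with
        | zero => simp [Nat.mod_eq_of_lt i.2]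
        | succ t ih =>
          rw [pow_succ', Equiv.Perm.mul_apply, finRotate_apply, Fin.val_add, ih]
          simp only [Fin.val_one', Nat.mod_add_mod, Nat.add_mod_mod]
          rfl
      ext
      rw [this, Fin.val_add]
    rw [← Fin.sum_univ_eq_sum_range (fun t => g ((finRotate (k + 1) ^ t) i))]
    simp only [hpow]
    exact Equiv.sum_comp (Equiv.addLeft i) g

/-- The permutation `0, …, m ↦ 0, …, ĵ, …, m, j`. -/
def insertLastPerm {m : ℕ} (j : Fin (m + 1)) : Equiv.Perm (Fin (m + 1)) :=
  j.cycleRange.symm * finRotate (m + 1)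

theorem insertLastPerm_castSucc {m : ℕ} (j : Fin (m + 1)) (i : Fin m) :
    insertLastPerm j i.castSucc = j.succAbove i := by
  rw [insertLastPerm, Equiv.Perm.mul_apply, finRotate_apply, Fin.coeSucc_eq_succ,
    Fin.cycleRange_symm_succ]

theorem insertLastPerm_last {m : ℕ} (j : Fin (m + 1)) : insertLastPerm j (Fin.last m) = j := by
  rw [insertLastPerm, Equiv.Perm.mul_apply, finRotate_last, Fin.cycleRange_symm_zero]

theorem sign_insertLastPerm {m : ℕ} (j : Fin (m + 1)) :
    Equiv.Perm.sign (insertLastPerm j) = (-1) ^ (m + (j : ℕ)) := by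
  rw [insertLastPerm, map_mul, Equiv.Perm.sign_symm, Fin.sign_cycleRange, sign_finRotate,
    ← pow_add, add_comm]
  rfl

/-- A permutation of the first `m` positions, extended by the last one. -/
def extendLastPerm {m : ℕ} (s : Equiv.Perm (Fin m)) : Equiv.Perm (Fin (m + 1)) :=
  s.viaFintypeEmbedding Fin.castSuccEmb

theorem extendLastPerm_castSucc {m : ℕ} (s : Equiv.Perm (Fin m)) (i : Fin m) :
    extendLastPerm s i.castSucc = (s i).castSucc :=
  s.viaFintypeEmbedding_apply_image Fin.castSuccEmb i

theorem extendLastPerm_last {m : ℕ} (s : Equiv.Perm (Fin m)) :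
    extendLastPerm s (Fin.last m) = Fin.last m :=
  s.viaFintypeEmbedding_apply_notMem_range Fin.castSuccEmb (by
    rintro ⟨i, hi⟩
    exact (Fin.castSucc_lt_last i).ne hi)

theorem sign_extendLastPerm {m : ℕ} (s : Equiv.Perm (Fin m)) :
    Equiv.Perm.sign (extendLastPerm s) = Equiv.Perm.sign s :=
  s.viaFintypeEmbedding_sign Fin.castSuccEmb

theorem Omega_of_bracket {K : Type*} [Field K] {m : ℕ} (hm : 1 ≤ m)
    {I : Ideal (MvPolynomial (Fin (m + 1)) K)} (F : MinimalFreeResolution I) {lam : K}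
    {p : Fin (F.rank 0)} {q : Fin (F.rank m)} {l : Fin m} (hl : (l : ℕ) + 1 = m)
    (h : ∀ τ : Equiv.Perm (Fin (m + 1)), F.bracket m (fun i => τ i.castSucc) p q =
      ((Equiv.Perm.sign τ : ℤ) : MvPolynomial (Fin (m + 1)) K) * C lam *
        ((X (τ (Fin.last m)) - X (τ 0) - X (τ l.castSucc)) * X (τ (Fin.last m))))
    (j : Fin (m + 1)) :
    F.Omega j p q = C ((-1) ^ (m + 1) * lam) *
      (((m + 2 : ℕ) : MvPolynomial (Fin (m + 1)) K) * X j ^ 2 - 2 * X j * ∑ i, X i) := by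
  set z : Fin m := ⟨0, by omega⟩ with hz
  set r := finRotate m with hr
  -- The first position is the rotation of the last, so the end positions after `2 * k` rotations
  -- are consecutive in the orbit of `l`. Even powers do not affect the sign.
  have hrl : r l = z := by
    obtain ⟨k, rfl⟩ : ∃ k, m = k + 1 := ⟨m - 1, by omega⟩
    have : l = Fin.last k := by ext; simpa using hl
    rw [this, hr, finRotate_last]; rfl
  have hb : ∀ k, F.bracket m (fun i => j.succAbove ((r ^ (2 * k)) i)) p q =
      (-1) ^ (m + (j : ℕ)) * C lam * ((X j - X (j.succAbove ((r ^ (2 * k + 1)) l)) -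
        X (j.succAbove ((r ^ (2 * k)) l))) * X j) := by
    intro k
    have h1 := h (insertLastPerm j * extendLastPerm (r ^ (2 * k)))
    have h2 : ∀ i : Fin m, (insertLastPerm j * extendLastPerm (r ^ (2 * k))) i.castSucc =
        j.succAbove ((r ^ (2 * k)) i) := by
      intro i
      rw [Equiv.Perm.mul_apply, extendLastPerm_castSucc, insertLastPerm_castSucc]
    simp only [h2] at h1
    rw [h1, show (0 : Fin (m + 1)) = z.castSucc from rfl,
      h2, Equiv.Perm.mul_apply,
      extendLastPerm_last, insertLastPerm_last, map_mul, sign_insertLastPerm, sign_extendLastPerm,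
      map_pow, pow_mul, Int.units_sq, one_pow, mul_one, pow_succ, Equiv.Perm.mul_apply, hrl]
    push_cast
    rfl
  have hdouble : ∀ (g : ℕ → MvPolynomial (Fin (m + 1)) K) (M : ℕ),
      ∑ k ∈ Finset.Icc 1 M, (g (2 * k + 1) + g (2 * k)) = ∑ t ∈ Finset.range (2 * M), g (t + 2) := by
    intro g M
    induction M with
    | zero => simp
    | succ M ih =>
      rw [Finset.sum_Icc_succ_top (by omega), ih, show 2 * (M + 1) = 2 * M + 1 + 1 by ring,
        Finset.sum_range_succ, Finset.sum_range_succ]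
      ring
  set g : ℕ → MvPolynomial (Fin (m + 1)) K := fun t => X (j.succAbove ((r ^ t) l)) with hg
  -- The exponents run through `2, …, 2 * m + 1`, two full turns, so each variable other than `X j`
  -- occurs twice.
  have hsum : ∑ k ∈ Finset.Icc 1 m, (g (2 * k + 1) + g (2 * k)) =
      2 * ∑ i, X (j.succAbove i) := by
    rw [hdouble, two_mul m, Finset.sum_range_add, two_mul]
    congr 1
    · rw [← sum_finRotate_pow _ ((r ^ 2) l)]
      refine Finset.sum_congr rfl fun t _ => ?_
      rw [hg, ← Equiv.Perm.mul_apply, ← pow_add]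
    · rw [← sum_finRotate_pow _ ((r ^ (m + 2)) l)]
      refine Finset.sum_congr rfl fun t _ => ?_
      rw [hg, ← Equiv.Perm.mul_apply, ← pow_add]
      simp only
      congr 4
      ring
  have hsum' : ∑ k ∈ Finset.Icc 1 m, F.bracket m (fun i => j.succAbove ((r ^ (2 * k)) i)) p q =
      (-1) ^ (m + (j : ℕ)) * C lam * (((m : MvPolynomial (Fin (m + 1)) K) * X j -
        2 * ∑ i, X (j.succAbove i)) * X j) := by
    rw [← hsum]
    simp only [hb]
    rw [← Finset.mul_sum, ← Finset.sum_mul]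
    congr 2
    have : ∀ k, X j - X (j.succAbove ((r ^ (2 * k + 1)) l)) - X (j.succAbove ((r ^ (2 * k)) l)) =
        X j - (g (2 * k + 1) + g (2 * k)) := fun k => by rw [hg]; ring
    simp only [this, Finset.sum_sub_distrib, Finset.sum_const, Nat.card_Icc, nsmul_eq_mul,
      Nat.add_sub_cancel]
  have hall : ∑ i, (X i : MvPolynomial (Fin (m + 1)) K) = X j + ∑ i, X (j.succAbove i) :=
    Fin.sum_univ_succAbove _ j
  rw [Omega, doubleBracket, Matrix.smul_apply, Matrix.sum_apply, hsum', hall, zsmul_eq_mul]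
  have hsign : ((-1 : MvPolynomial (Fin (m + 1)) K)) ^ ((j : ℕ) + 1) * (-1) ^ (m + (j : ℕ)) =
      (-1) ^ (m + 1) := by
    rw [← pow_add, show (j : ℕ) + 1 + (m + j) = m + 1 + 2 * j by ring, pow_add, pow_mul]
    simp
  push_cast
  rw [C_mul, map_pow, C_neg, C_1, ← hsign]
  ring

end Rotation

end MinimalFreeResolution

/-! ### The case of three points on a line, the general case, and the conclusion. -/

theorem IsHomogeneousOfIntDegree.isHomogeneous {σ K : Type*} [CommSemiring K]
    {p : MvPolynomial σ K} {e : ℤ} (hp : IsHomogeneousOfIntDegree p e) {d : ℕ} (hd : e = d) :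
    p.IsHomogeneous d := by
  obtain rfl | ⟨d', hd', hp⟩ := hp
  · exact isHomogeneous_zero _ _ _
  · obtain rfl : d' = d := by omega
    exact hp

/-- The cubics that vanish at three standard points of the projective line. -/
theorem exists_eq_of_cubic {K : Type*} [Field K] {p : MvPolynomial (Fin 2) K}
    (hp : p.IsHomogeneous 3) (h0 : eval (Pi.single 0 1) p = 0) (h1 : eval (Pi.single 1 1) p = 0)
    (h : eval 1 p = 0) : ∃ μ : K, p = C μ * (X 0 * X 1 * (X 0 - X 1)) := by
  set f : ℕ → (Fin 2 →₀ ℕ) := fun i => Finsupp.single 0 i + Finsupp.single 1 (3 - i) with hf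
  have hs : ∀ s : Fin 2 →₀ ℕ, s.degree = s 0 + s 1 := by
    intro s
    rw [Finsupp.degree_eq_sum, Fin.sum_univ_two]
  have hexp : p = ∑ i ∈ Finset.range 4, monomial (f i) (coeff (f i) p) := by
    ext s
    rw [coeff_sum]
    simp only [coeff_monomial]
    by_cases hd : s.degree = 3
    · have hfs : f (s 0) = s := by
        rw [hs] at hd
        ext i
        fin_cases i
        · simp [hf]
        · simp [hf]; omega
      rw [Finset.sum_eq_single (s 0)]
      · rw [if_pos hfs, hfs]
      · intro i _ hi
        rw [if_neg]
        rintro rfl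
        simp [hf] at hi
      · intro hn
        rw [hs] at hd
        simp at hn
        omega
    · rw [hp.coeff_eq_zero hd, Finset.sum_eq_zero]
      intro i hi
      rw [if_neg]
      rintro rfl
      rw [Finset.mem_range] at hi
      rw [hs] at hd
      simp [hf] at hd
      omega
  have hmon : ∀ i r, monomial (f i) r = C r * (X 0 ^ i * X 1 ^ (3 - i) : MvPolynomial (Fin 2) K) := by
    intro i r
    rw [X_pow_eq_monomial, X_pow_eq_monomial, monomial_mul, C_mul_monomial]
    simp [hf]
  simp only [hmon, Finset.sum_range_succ, Finset.sum_range_zero] at hexp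
  generalize coeff (f 0) p = a at hexp
  generalize coeff (f 1) p = b at hexp
  generalize coeff (f 2) p = c at hexp
  generalize coeff (f 3) p = d at hexp
  subst hexp
  simp at h0 h1 h
  refine ⟨c, ?_⟩
  obtain rfl : d = 0 := h0
  obtain rfl : a = 0 := h1
  obtain rfl : b = -c := by linear_combination h
  simp only [C_0, C_neg]
  ring

namespace MinimalFreeResolution

variable {K : Type*} [Field K]

theorem φ_zero_mem {σ : Type*} {I : Ideal (MvPolynomial σ K)} {F : MinimalFreeResolution I}
    {i₀ : Fin (F.rank 0)} (hmem : ∀ p, p ∈ I ↔ ∃ v, (F.φ 0).mulVec v i₀ = p) (l) :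
    F.φ 0 i₀ l ∈ I :=
  (hmem _).2 ⟨Pi.single l 1, by rw [Matrix.mulVec_single_one]; rfl⟩

theorem rank_last_eq_one {m : ℕ} (hm : 1 ≤ m)
    (F : MinimalFreeResolution (projVanishingIdeal (standardPoints K m))) (h : F.rank m ≤ 1) :
    F.rank m = 1 := by
  have := F.rank_last_ne_zero hm
  omega

/-- Here every column of the single differential is a multiple of one cubic, and the bracket is its
partial derivative. -/
theorem bracket_of_one (F : MinimalFreeResolution (projVanishingIdeal (standardPoints K 1))) :
    F.rank 0 = 1 ∧ F.rank 1 = 1 ∧ ∃ lam : K, lam ≠ 0 ∧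
      ∀ (τ : Equiv.Perm (Fin (1 + 1))) (p : Fin (F.rank 0)) (q : Fin (F.rank 1)),
        F.bracket 1 (fun i => τ i.castSucc) p q =
          ((Equiv.Perm.sign τ : ℤ) : MvPolynomial (Fin (1 + 1)) K) * C lam *
            ((X (τ (Fin.last 1)) - X (τ 0) - X (τ ⟨1 - 1, by omega⟩)) * X (τ (Fin.last 1))) := by
  obtain ⟨i₀, huniq, hdeg, hmem⟩ :=
    F.exists_unique_generator fun p hp => coeff_zero_of_mem_projVanishingIdeal hp
  have hcub : ∀ q, ∃ μ : K, F.φ 0 i₀ q = C μ * (X 0 * X 1 * (X 0 - X 1)) := by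
    intro q
    have hh : (F.φ 0 i₀ q).IsHomogeneous 3 := (F.φ_graded 0 i₀ q).isHomogeneous (by
      rw [hdeg, F.deg_eq_last le_rfl]; norm_num)
    have hv := (mem_projVanishingIdeal_iff hh).1 (φ_zero_mem hmem q)
    exact exists_eq_of_cubic hh (hv (some 0)) (hv (some 1)) (hv none)
  choose μ hμ using hcub
  obtain ⟨hr, hμ0⟩ := le_one_and_ne_zero_of_linear_form μ fun w hw => by
    refine F.eq_zero_of_φ_mulVec_C_eq_zero (k := 0) ?_
    ext1 i
    rw [huniq i]
    simp only [Matrix.mulVec, dotProduct]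
    calc ∑ q, F.φ 0 i₀ q * C (w q) = ∑ q, C (w q * μ q) * (X 0 * X 1 * (X 0 - X 1)) :=
          Finset.sum_congr rfl fun q _ => by rw [hμ, C_mul]; ring
      _ = 0 := by rw [← Finset.sum_mul, ← map_sum, hw, C_0, zero_mul]
  have hr1 := rank_last_eq_one le_rfl F hr
  have hr0 : F.rank 0 = 1 := by
    have : Subsingleton (Fin (F.rank 0)) := ⟨fun a b => (huniq a).trans (huniq b).symm⟩
    have h2 := Fin.subsingleton_iff_le_one.1 this
    have := i₀.2
    omega
  have hsub : Subsingleton (Fin (F.rank 1)) := Fin.subsingleton_iff_le_one.2 hr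
  let q₀ : Fin (F.rank 1) := ⟨0, by omega⟩
  refine ⟨hr0, hr1, -μ q₀, neg_ne_zero.2 (hμ0 q₀), fun τ p q => ?_⟩
  rw [huniq p, Subsingleton.elim q q₀]
  have hb : F.bracket 1 (fun i => τ i.castSucc) i₀ q₀ = pderiv (τ 0) (F.φ 0 i₀ q₀) := by
    simp only [bracket]
    rw [Matrix.one_mul]
    rfl
  have hτ : ∀ τ : Equiv.Perm (Fin 2), τ = 1 ∨ τ = Equiv.swap 0 1 := by decide
  rw [hb, hμ]
  have h01 : (0 : Fin 2) ≠ 1 := by decide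
  rcases hτ τ with rfl | rfl
  · have h2 : (Fin.last 1 : Fin 2) = 1 := rfl
    have h3 : (⟨1 - 1, by omega⟩ : Fin 2) = 0 := rfl
    simp only [Equiv.Perm.one_apply, h2, h3, pderiv_mul, pderiv_C, map_sub, pderiv_X_self,
      pderiv_X_of_ne h01.symm, Equiv.Perm.sign_one, C_neg]
    push_cast
    ring
  · have h2 : Equiv.swap (0 : Fin 2) 1 (Fin.last 1) = 0 := rfl
    have h3 : Equiv.swap (0 : Fin 2) 1 ⟨1 - 1, by omega⟩ = 1 := rfl
    have h4 : Equiv.swap (0 : Fin 2) 1 0 = 1 := rfl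
    simp only [h2, h3, h4, pderiv_mul, pderiv_C, map_sub, pderiv_X_self,
      pderiv_X_of_ne h01, Equiv.Perm.sign_swap h01, C_neg]
    push_cast
    ring

theorem exists_linearStrand {n : ℕ}
    (F : MinimalFreeResolution (projVanishingIdeal (standardPoints K (n + 2)))) :
    ∃ i₀, F.LinearStrand i₀ n := by
  obtain ⟨i₀, huniq, hdeg, hmem⟩ :=
    F.exists_unique_generator fun p hp => coeff_zero_of_mem_projVanishingIdeal hp
  have hh : ∀ l, (F.φ 0 i₀ l).IsHomogeneous 2 := fun l =>
    (F.φ_graded 0 i₀ l).isHomogeneous (by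
      rw [hdeg, F.deg_eq_of_lt (by omega) (Nat.succ_ne_zero 0) (by omega)]; norm_num)
  have hv := fun l => (mem_projVanishingIdeal_iff (hh l)).1 (φ_zero_mem hmem l)
  refine ⟨i₀, huniq, hh, fun a l => hv l (some a), fun l => hv l none, fun j hj hjn i l => ?_⟩
  refine (F.φ_graded j i l).isHomogeneous ?_
  rw [F.deg_eq_of_lt (by omega) (Nat.succ_ne_zero j) (by omega),
    F.deg_eq_of_lt (by omega) hj (by omega)]
  push_cast
  ring

theorem bracket_of_two_le {n : ℕ}
    (F : MinimalFreeResolution (projVanishingIdeal (standardPoints K (n + 2)))) :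
    F.rank 0 = 1 ∧ F.rank (n + 2) = 1 ∧ ∃ lam : K, lam ≠ 0 ∧
      ∀ (τ : Equiv.Perm (Fin (n + 2 + 1))) (p : Fin (F.rank 0)) (q : Fin (F.rank (n + 2))),
        F.bracket (n + 2) (fun i => τ i.castSucc) p q =
          ((Equiv.Perm.sign τ : ℤ) : MvPolynomial (Fin (n + 2 + 1)) K) * C lam *
            ((X (τ (Fin.last (n + 2))) - X (τ 0) - X (τ ⟨n + 2 - 1, by omega⟩)) *
              X (τ (Fin.last (n + 2)))) := by
  obtain ⟨i₀, h⟩ := F.exists_linearStrand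
  have hy : ∀ q, (F.φ n).mulVec (fun l => F.φ (n + 1) l q) = 0 := by
    intro q
    ext1 i
    exact congrFun (congrFun (F.φ_mul_φ n) i) q
  have hyh : ∀ q l, (F.φ (n + 1) l q).IsHomogeneous 2 := fun q l =>
    (F.φ_graded (n + 1) l q).isHomogeneous (by
      rw [F.deg_eq_last (by omega), F.deg_eq_of_lt (by omega) (Nat.succ_ne_zero n) (by omega)]
      push_cast; ring)
  choose μ hμ using fun q => h.exists_hasScalar_perm (hy q) (hyh q)
  -- The scalar is linear in the column. A combination of columns with scalar zero vanishes, and by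
  -- minimality its coefficients vanish too.
  obtain ⟨hr, hμ0⟩ := le_one_and_ne_zero_of_linear_form μ fun w hw => by
    refine F.eq_zero_of_φ_mulVec_C_eq_zero ?_
    refine h.eq_zero_of_perm fun ν => ?_
    have hp : ∀ (d : ℕ → Fin (n + 3)) (a b), F.pairing i₀ n d
        ((F.φ (n + 1)).mulVec fun q => C (w q)) a b =
        ∑ q, C (w q) * F.pairing i₀ n d (fun l => F.φ (n + 1) l q) a b := by
      intro d a b
      simp only [pairing, Matrix.mulVec, dotProduct, Finset.mul_sum]
      rw [Finset.sum_comm]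
      exact Finset.sum_congr rfl fun q _ => Finset.sum_congr rfl fun l _ => by ring
    have hz : ∀ z : MvPolynomial (Fin (n + 3)) K,
        ∑ q, C (w q) * (C (((Equiv.Perm.sign ν : ℤ) : K) * μ q) * z) = C 0 * z := by
      intro z
      rw [← mul_zero ((Equiv.Perm.sign ν : ℤ) : K), ← hw, Finset.mul_sum, map_sum, Finset.sum_mul]
      exact Finset.sum_congr rfl fun q _ => by simp only [C_mul]; ring
    refine ⟨?_, ?_, ?_⟩
    · rw [hp, ← hz]
      exact Finset.sum_congr rfl fun q _ => by rw [(hμ q ν).1]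
    · rw [hp, ← hz]
      exact Finset.sum_congr rfl fun q _ => by rw [(hμ q ν).2.1]
    · rw [hp, ← hz]
      exact Finset.sum_congr rfl fun q _ => by rw [(hμ q ν).2.2]
  have hr1 := rank_last_eq_one (by omega) F hr
  have hr0 : F.rank 0 = 1 := by
    have : Subsingleton (Fin (F.rank 0)) := ⟨fun a b => (h.eq_zero a).trans (h.eq_zero b).symm⟩
    have h2 := Fin.subsingleton_iff_le_one.1 this
    have := i₀.2
    omega
  have hsub : Subsingleton (Fin (F.rank (n + 2))) := Fin.subsingleton_iff_le_one.2 hr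
  let q₀ : Fin (F.rank (n + 2)) := ⟨0, by omega⟩
  refine ⟨hr0, hr1, (-1) ^ (n + 2) * μ q₀, mul_ne_zero (by simp) (hμ0 q₀), fun τ p q => ?_⟩
  rw [h.eq_zero p, Subsingleton.elim q q₀]
  set a : ℕ → Fin (n + 3) := fun i => τ (Fin.ofNat (n + 3) i) with ha
  -- The shift by one required by `bracket_of_hasScalar` is a rotation of all `n + 3` positions,
  -- whose sign is the factor `(-1) ^ (n + 2)` in the chosen scalar.
  have hshift : (fun i => (τ * finRotate (n + 3)) (Fin.ofNat (n + 3) i)) = fun i => a (i + 1) := by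
    ext1 i
    rw [ha, Equiv.Perm.mul_apply, finRotate_apply]
    congr 1
    ext
    simp [Fin.val_add]
  have hbij := bijective_ofNat (τ * finRotate (n + 3))
  have hsc := hμ q₀ (τ * finRotate (n + 3))
  rw [hshift] at hsc
  have hb := h.bracket_of_hasScalar (a := a) (by simp [ha]) (by
    have : (fun i : Fin (n + 3) => a (i + 1)) =
        fun i : Fin (n + 3) => (τ * finRotate (n + 3)) (Fin.ofNat (n + 3) i) :=
      funext fun i => (congrFun hshift i).symm
    rw [this]; exact hbij) hsc
  have e1 : (fun i : Fin (n + 2) => τ i.castSucc) = fun i : Fin (n + 2) => a i := by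
    ext1 i
    rw [ha]
    congr 1
    ext
    simp
  have e2 : Fin.ofNat (n + 3) (n + 2) = Fin.last (n + 2) := by ext; simp
  have e3 : Fin.ofNat (n + 3) 0 = 0 := by ext; simp
  have e4 : Fin.ofNat (n + 3) (n + 1) = ⟨n + 2 - 1, by omega⟩ := by
    ext; simp
  rw [e1, hb]
  simp only [ha, e2, e3, e4]
  rw [Equiv.Perm.sign_mul, sign_finRotate, Nat.add_sub_cancel (n := n + 2) (m := 1), C_mul, C_mul]
  push_cast
  simp only [map_mul, map_pow, C_neg, C_1, map_intCast]
  ring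

end MinimalFreeResolution

theorem mainTheorem6 {K : Type*} [Field K] (m : ℕ) (hm : 1 ≤ m)
    (F : MinimalFreeResolution (projVanishingIdeal (standardPoints K m))) :
    F.rank 0 = 1 ∧ F.rank m = 1 ∧
    (∃ lam : K, lam ≠ 0 ∧
      ∀ (τ : Equiv.Perm (Fin (m + 1))) (p : Fin (F.rank 0)) (q : Fin (F.rank m)),
        F.bracket m (fun i => τ i.castSucc) p q =
          ((Equiv.Perm.sign τ : ℤ) : MvPolynomial (Fin (m + 1)) K) * C lam *
            ((X (τ (Fin.last m)) - X (τ 0) - X (τ ⟨m - 1, by omega⟩)) * X (τ (Fin.last m)))) ∧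
    (∃ c : K, c ≠ 0 ∧
      ∀ (i : Fin (m + 1)) (p : Fin (F.rank 0)) (q : Fin (F.rank m)),
        F.Omega i p q =
          C c * (((m + 2 : ℕ) : MvPolynomial (Fin (m + 1)) K) * X i ^ 2 -
            2 * X i * ∑ j, X j)) := by
  have key : F.rank 0 = 1 ∧ F.rank m = 1 ∧ ∃ lam : K, lam ≠ 0 ∧
      ∀ (τ : Equiv.Perm (Fin (m + 1))) (p : Fin (F.rank 0)) (q : Fin (F.rank m)),
        F.bracket m (fun i => τ i.castSucc) p q =
          ((Equiv.Perm.sign τ : ℤ) : MvPolynomial (Fin (m + 1)) K) * C lam *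
            ((X (τ (Fin.last m)) - X (τ 0) - X (τ ⟨m - 1, by omega⟩)) * X (τ (Fin.last m))) := by
    obtain rfl | ⟨n, rfl⟩ : m = 1 ∨ ∃ n, m = n + 2 := by
      rcases Nat.lt_or_ge 1 m with h | h
      · exact Or.inr ⟨m - 2, by omega⟩
      · exact Or.inl (by omega)
    · exact F.bracket_of_one
    · exact F.bracket_of_two_le
  obtain ⟨h0, h1, lam, hlam, h⟩ := key
  exact ⟨h0, h1, ⟨lam, hlam, h⟩, (-1) ^ (m + 1) * lam, mul_ne_zero (by simp) hlam,
    fun i p q => F.Omega_of_bracket hm (l := ⟨m - 1, by omega⟩) (Nat.sub_add_cancel hm) (fun τ => h τ p q) i⟩
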